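/- Let $I$ be a finite set of items. A dataset is a finite bag (multiset) of transactions, i.e. of subsets of $I$. For a binary matrix $M$ with columns indexed by $I$, let $D(M)$ be the dataset whose transactions are the rows of $M$. The bipartite joint degree matrix (BJDM) of $M$ has as its $(i,j)$ entry the number of cells $(a,c)$ with $M[a,c]=1$, where row $a$ has sum $i$ and column $c$ has sum $j$. The BJDM of a dataset $D$ is that of any matrix $M$ with $D(M)=D$. Let $D_0$ be the observed dataset and $M_0$ a binary matrix with $D(M_0)=D_0$. Let $\mathcal M$ be the set of binary matrices of the same size as $M_0$ that have the same row sums, the same column sums and the same BJDM as $M_0$. Let $\mathcal Z$ (the null set) be the set of datasets over $I$ that have the same number of transactions of each length, the same support of each item (number of transactions containing it) and the same BJDM as $D_0$. Let $P$ be a probability distribution on $\mathcal Z$. For a dataset $D$ let $$C(D)=\prod_{\ell}\frac{|T_\ell|!}{\prod_{\tau}|Q_{\ell,\tau}|!},$$ where $\ell$ runs over the distinct transaction lengths in $D$, $T_\ell$ is the bag of transactions of $D$ of length $\ell$, $\tau$ runs over the distinct elements of $T_\ell$, and $|Q_{\ell,\tau}|$ is the multiplicity of $\tau$ in $T_\ell$.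 For $M\in\mathcal M$ put $\pi(M)=P(D(M))/C(D(M))$. A restricted swap operation (RSO) $(a,c),(b,d)\to(a,d),(b,c)$ on $M$, with rows $a\ne b$ and columns $c\neq d$ such that $M[a,c]=M[b,d]=1$, $M[a,d]=M[b,c]=0$, and such that rows $a,b$ have equal sums or columns $c,d$ have equal sums, exchanges the entries in columns $c$ and $d$ within each of the rows $a$ and $b$. The proposal distribution $\nu_M$ is the law of the matrix $M'$ obtained as follows. Flip a fair coin. On heads, let $A_m$ be the set of rows of $M$ with sum $m$; draw $m\in\{1,\dots,|I|\}$ with probability $\binom{|A_m|}{2}/\sum_{j=1}^{|I|}\binom{|A_j|}{2}$, then a pair of different rows $a,b$ uniformly from $A_m$. If the two rows are identical, let $M'=M$. Otherwise draw $(c,d)$ uniformly from the pairs of columns with $M[a,c]=M[b,d]$, $M[a,d]=M[b,c]$ and $M[a,c]\ne M[a,d]$, and let $M'$ be the result of the corresponding RSO on the rows $a,b$ and the columns $c,d$. If no two different rows have the same positive sum, let $M'=M$. On tails, do the same with the roles of rows and columns exchanged. Alice-A is the Metropolis–Hastings chain with proposals $\nu_M$ and target $\pi$: from $M$ it proposes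 $M'$ drawn from $\nu_M$ and moves to $M'$ with probability $\min\{1,\ \pi(M')\nu_{M'}(M)/(\pi(M)\nu_M(M'))\}$, otherwise it stays in $M$ (with the conventions $0/0=0$ and $x/0=\infty$ for $x>0$ in this quotient, which matter only when $\pi(M)=0$). After $s$ steps it outputs $D(M_s)$, where $M_s$ is the current matrix. Then: 1. For $M\in\mathcal M$, every result of an RSO on $M$ is in $\mathcal M$ and is proposed with positive probability, and every matrix proposed with positive probability is $M$ or the result of an RSO on $M$. 2. $\nu_M(M')=\nu_{M'}(M)$ for all $M,M'\in\mathcal M$. 3. For every $D\in\mathcal Z$, exactly $C(D)$ matrices $M\in\mathcal M$ satisfy $D(M)=D$. 4. $\pi$ is a probability distribution on $\mathcal M$ and is stationary for Alice-A. If the starting matrix has law $\pi$, then for every $s$ the output after $s$ steps has law $P$. 5. If $P(D)>0$ for every $D\in\mathcal Z$, then $\pi$ is the only stationary distribution of Alice-A on $\mathcal M$, and for every starting matrix $M\in\mathcal M$ and every $D\in\mathcal Z$ the probability that Alice-A outputs $D$ after $s$ steps tends to $P(D)$ as $s\to\infty$. -/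

import Mathlib

open scoped ENNReal Topology

namespace Alice

/-! ### Datasets, binary matrices and bipartite joint degree matrices

Items form a finite type `κ`. A transaction is a finite set of items and a dataset is a finite
bag (multiset) of transactions. Binary matrices have Boolean entries, with `true` for `1`. -/

section Matrices

variable {ρ κ : Type*} [Fintype ρ] [Fintype κ]

/-- The sum of row `a`, i.e. the degree of the left vertex `a`. -/
def rowSum (M : Matrix ρ κ Bool) (a : ρ) : ℕ :=
  (Finset.univ.filter fun j => M a j = true).card

/-- The sum of column `c`, i.e. the degree of the right vertex `c`. -/
def colSum (M : Matrix ρ κ Bool) (c : κ) : ℕ :=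
  (Finset.univ.filter fun i => M i c = true).card

/-- The bipartite joint degree matrix of the bipartite graph with biadjacency matrix `M`: the
`(i, j)` entry is the number of edges joining a left vertex of degree `i` to a right vertex of
degree `j`. It is padded by zeros to a function on all of `ℕ × ℕ`. -/
def bjdm (M : Matrix ρ κ Bool) (i j : ℕ) : ℕ :=
  (Finset.univ.filter fun e : ρ × κ =>
    M e.1 e.2 = true ∧ rowSum M e.1 = i ∧ colSum M e.2 = j).card

/-- The dataset `D(M)` whose transactions are the rows of `M`. -/
def toDataset (M : Matrix ρ κ Bool) : Multiset (Finset κ) :=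
  Finset.univ.val.map fun a => Finset.univ.filter fun j => M a j = true

/-- The state space: the matrices with the same row sums, the same column sums and the same
bipartite joint degree matrix as the observed matrix. -/
def matrices (Mobs : Matrix ρ κ Bool) : Set (Matrix ρ κ Bool) :=
  {M | (∀ a, rowSum M a = rowSum Mobs a) ∧ (∀ c, colSum M c = colSum Mobs c) ∧
    bjdm M = bjdm Mobs}

end Matrices

section Datasets

variable {κ : Type*} [DecidableEq κ]

/-- The number of transactions of `D` of length `l`. -/
def numLength (D : Multiset (Finset κ)) (l : ℕ) : ℕ :=
  Multiset.card (D.filter fun t => t.card = l)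

/-- The support of the item `i` in `D`. -/
def itemSupport (D : Multiset (Finset κ)) (i : κ) : ℕ :=
  Multiset.card (D.filter fun t => i ∈ t)

/-- The biadjacency matrix of the bipartite graph of `D`, whose left vertices are the transactions
of `D`, counted with multiplicity. -/
def datasetMatrix (D : Multiset (Finset κ)) : Matrix D κ Bool :=
  fun t i => decide (i ∈ t.1)

/-- The null set: the datasets that share with the observed dataset the number of transactions of
each length, the support of each item, and the bipartite joint degree matrix. -/
def nullSet [Fintype κ] (Dobs : Multiset (Finset κ)) : Set (Multiset (Finset κ)) :=
  {D | (∀ l, numLength D l = numLength Dobs l) ∧ (∀ i, itemSupport D i = itemSupport Dobs i) ∧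
    bjdm (datasetMatrix D) = bjdm (datasetMatrix Dobs)}

/-- The number `C(D)`: the product over the distinct transaction lengths `l` of the multinomial
coefficient `|T|! / ∏ |Q_j|!`, where `T` is the bag of the transactions of length `l` and the
`|Q_j|` are the multiplicities of its distinct elements. -/
def copies (D : Multiset (Finset κ)) : ℕ :=
  ∏ l ∈ (D.map Finset.card).toFinset,
    Nat.multinomial (D.filter fun t => t.card = l).toFinset
      (fun τ => (D.filter fun t => t.card = l).count τ)

end Datasets

/-! ### Restricted swap operations -/

section Swaps

variable {ρ κ : Type*} [Fintype ρ] [Fintype κ] [DecidableEq ρ] [DecidableEq κ]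

/-- Exchange the entries in columns `c` and `d` within each of the rows `a` and `b`. -/
def swapEntries (M : Matrix ρ κ Bool) (a b : ρ) (c d : κ) : Matrix ρ κ Bool :=
  fun i j => if i = a ∨ i = b then M i (Equiv.swap c d j) else M i j

/-- `M'` is obtained from `M` by a restricted swap operation `(a, c), (b, d) → (a, d), (b, c)`. -/
def IsRSO (M M' : Matrix ρ κ Bool) : Prop :=
  ∃ (a b : ρ) (c d : κ), a ≠ b ∧ c ≠ d ∧
    M a c = true ∧ M b d = true ∧ M a d = false ∧ M b c = false ∧
    (rowSum M a = rowSum M b ∨ colSum M c = colSum M d) ∧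
    M' = swapEntries M a b c d

end Swaps

/-! ### Random choices -/

noncomputable section

section Random

variable {α β S : Type*}

/-- A coin that shows `true` with probability `p`. -/
def coin (p : ℝ≥0∞) (hp : p ≤ 1) : PMF Bool :=
  PMF.ofFintype (fun x => cond x p (1 - p)) (by simp [hp])

theorem sum_weights {s : Finset α} {w : α → ℕ} (h : ∑ x ∈ s, w x ≠ 0) :
    ∑ x ∈ s, (w x : ℝ≥0∞) / ((∑ y ∈ s, w y : ℕ) : ℝ≥0∞) = 1 := by
  simp only [div_eq_mul_inv]
  rw [← Finset.sum_mul, ← Nat.cast_sum]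
  exact ENNReal.mul_inv_cancel (by exact_mod_cast h) (ENNReal.natCast_ne_top _)

open Classical in
/-- Draw an element `x` of `s` with probability `w x / ∑ y ∈ s, w y`. -/
def weightedDraw (s : Finset α) (w : α → ℕ) (h : ∑ x ∈ s, w x ≠ 0) : PMF α :=
  PMF.ofFinset
    (fun x => if x ∈ s then (w x : ℝ≥0∞) / ((∑ y ∈ s, w y : ℕ) : ℝ≥0∞) else 0) s
    (by
      rw [← sum_weights h]
      exact Finset.sum_congr rfl fun x hx => if_pos hx)
    (fun x hx => if_neg hx)

/-- Draw an element of `s` uniformly at random and continue with `k`; return `y` if `s` is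
empty. -/
def uniformDrawOr (s : Finset α) (y : β) (k : α → PMF β) : PMF β :=
  open Classical in
  if h : s.Nonempty then (PMF.uniformOfFinset s h).bind k else PMF.pure y

/-- The Metropolis–Hastings acceptance probability of a move from `v` to `u`, for the target `π`
and the proposal distributions `q`. -/
def mhAccept (π : S → ℝ≥0∞) (q : S → PMF S) (v u : S) : ℝ≥0∞ :=
  min 1 ((π u * q u v) / (π v * q v u))

/-- One step of the Metropolis–Hastings algorithm: propose `u` according to `q v`, move to `u` with
the acceptance probability, and otherwise stay in `v`. -/
def mhStep (π : S → ℝ≥0∞) (q : S → PMF S) (v : S) : PMF S :=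
  (q v).bind fun u => (coin (mhAccept π q v u) (min_le_left _ _)).bind fun x =>
    PMF.pure (if x then u else v)

/-- The distribution of the state of a Markov chain with transition kernel `K`, started in `v`,
after `s` steps. -/
def chain (K : S → PMF S) (v : S) : ℕ → PMF S
  | 0 => PMF.pure v
  | s + 1 => (chain K v s).bind K

end Random

/-! ### The algorithm -/

section Algorithm

variable {ρ κ : Type*} [Fintype ρ] [Fintype κ] [DecidableEq ρ] [DecidableEq κ]

/-- The set `A_m` of the indices of the rows of `M` with sum `m`. -/
def rowsOfSum (M : Matrix ρ κ Bool) (m : ℕ) : Finset ρ :=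
  Finset.univ.filter fun a => rowSum M a = m

/-- The set `H_{a,b}` of pairs of column indices between which rows `a` and `b` can be swapped. -/
def swapPairs (M : Matrix ρ κ Bool) (a b : ρ) : Finset (κ × κ) :=
  Finset.univ.filter fun e => M a e.1 = M b e.2 ∧ M a e.2 = M b e.1 ∧ M a e.1 ≠ M a e.2

/-- The move proposed when the outcome of the coin flip is heads. A row sum `1 ≤ m ≤ |κ|` is drawn
with probability proportional to `|A_m|.choose 2`, then a pair of different rows `a, b` uniformly
from `A_m`. If the rows are identical the proposal is `M`; otherwise a pair of columns `c, d` is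
drawn uniformly from `H_{a,b}`, and the proposal is the result of the corresponding swap. If no two
different rows have the same positive sum, the proposal is `M`. -/
def rowProposal (M : Matrix ρ κ Bool) : PMF (Matrix ρ κ Bool) :=
  if h : ∑ m ∈ Finset.Icc 1 (Fintype.card κ), (rowsOfSum M m).card.choose 2 ≠ 0 then
    (weightedDraw (Finset.Icc 1 (Fintype.card κ)) (fun m => (rowsOfSum M m).card.choose 2) h).bind
      fun m => uniformDrawOr (rowsOfSum M m).offDiag M fun r =>
        if M r.1 = M r.2 then PMF.pure M
        else uniformDrawOr (swapPairs M r.1 r.2) M fun e =>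
          PMF.pure (swapEntries M r.1 r.2 e.1 e.2)
  else PMF.pure M

/-- The move proposed when the outcome of the coin flip is tails: the same procedure with the roles
of rows and columns exchanged. -/
def colProposal (M : Matrix ρ κ Bool) : PMF (Matrix ρ κ Bool) :=
  (rowProposal M.transpose).map Matrix.transpose

/-- The neighbour sampling distribution `ν_M`. -/
def proposal (M : Matrix ρ κ Bool) : PMF (Matrix ρ κ Bool) :=
  (PMF.uniformOfFintype Bool).bind fun heads =>
    if heads then rowProposal M else colProposal M

/-- The target `π(M) = P(D(M)) / C(D(M))`. -/
def target (P : PMF (Multiset (Finset κ))) (M : Matrix ρ κ Bool) : ℝ≥0∞ :=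
  P (toDataset M) / copies (toDataset M)

/-- One step of the chain: the Metropolis–Hastings step with target `π` and proposals `ν_M`. -/
def aliceStep (P : PMF (Multiset (Finset κ))) (M : Matrix ρ κ Bool) : PMF (Matrix ρ κ Bool) :=
  mhStep (target P) proposal M

/-- The distribution of the dataset that is output after `s` steps from the matrix `M`. -/
def aliceOutput (P : PMF (Multiset (Finset κ))) (s : ℕ) (M : Matrix ρ κ Bool) :
    PMF (Multiset (Finset κ)) :=
  (chain (aliceStep P) M s).map toDataset

end Algorithm

end

end Alice

namespace Alice

/-! ### Swaps and spectra -/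

section Connectivity

variable {ρ κ δ γ : Type*} [Fintype ρ] [Fintype κ] [DecidableEq ρ] [DecidableEq κ]
  [DecidableEq δ] [DecidableEq γ]

/-! Two points need work: irreducibility, and convergence of the output although the chain may be
periodic.

Irreducibility. The spectrum of a row lists its numbers of ones in the classes of columns of equal
sum. Matrices with equal row and column spectra are joined by swaps inside blocks, one row at a time
(`reflTransGen_of_spec_eq`). To equalise row spectra, swap between rows of equal sum until the
spectra in each class differ by at most one (`exists_balanced`). The BJDM fixes the class totals, so
the two balanced matrices have spectra `q + t` with a common `q` and 0-1 residuals `t` of equal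
margins. The residuals are joined by swaps, and these lift to the matrices (`exists_lift`). Swaps
between rows of equal sum preserve column spectra, so the transposed argument equalises the column
spectra without spoiling the row spectra (`reflTransGen_of_joint_eq`).

Stationarity. Row permutations that preserve row sums act transitively on the matrices of a dataset,
and the stabiliser has order the product of the factorials of the multiplicities; this yields
`copies`. Hence the target is the law of a uniform matrix of a `P`-random dataset (`matrixLaw`), and
Metropolis–Hastings balance makes it stationary.

Convergence. For an irreducible reversible chain only the eigenvalue -1 can obstruct convergence. A
(-1)-eigenfunction changes sign along every transition, and also under the exchange of two rows of
equal positive sum (`rowExchange_sign`), whereas the output ignores that exchange. So the observable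
is orthogonal to all such eigenfunctions and converges anyway (`tendsto_iterate`). If no two rows
have equal positive sum, heads gives a self-loop and no nonzero (-1)-eigenfunction exists. -/

theorem exists_of_card_lt {α : Type*} [Fintype α] {p : α → Prop} [DecidablePred p]
    {u v : α → Bool}
    (h : (Finset.univ.filter fun x => p x ∧ u x = true).card <
      (Finset.univ.filter fun x => p x ∧ v x = true).card) :
    ∃ b, p b ∧ v b = true ∧ u b = false := by
  by_contra! hc
  refine absurd (Finset.card_le_card ?_) (not_le.2 h)
  intro x hx
  simp only [Finset.mem_filter, Finset.mem_univ, true_and] at hx ⊢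
  exact ⟨hx.1, by simpa using hc x hx.1 hx.2⟩

theorem exists_of_card_le {α : Type*} [Fintype α] {p : α → Prop} [DecidablePred p]
    {u v : α → Bool} {a : α}
    (h : (Finset.univ.filter fun x => p x ∧ u x = true).card ≤
      (Finset.univ.filter fun x => p x ∧ v x = true).card)
    (ha : p a) (hu : u a = true) (hv : v a = false) :
    ∃ b, p b ∧ v b = true ∧ u b = false := by
  by_contra! hc
  refine absurd (Finset.card_lt_card ?_) (not_lt.2 h)
  rw [Finset.ssubset_iff_of_subset]
  · exact ⟨a, by simp [ha, hu], by simp [hv]⟩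
  intro x hx
  simp only [Finset.mem_filter, Finset.mem_univ, true_and] at hx ⊢
  exact ⟨hx.1, by simpa using hc x hx.1 hx.2⟩

/-- A swap `(a, c), (b, d) → (a, d), (b, c)` on `M` whose rows and columns are related by `R`. -/
def IsSwap (R : ρ → ρ → κ → κ → Prop) (M M' : Matrix ρ κ Bool) : Prop :=
  ∃ a b c d, R a b c d ∧ M a c = true ∧ M b d = true ∧ M a d = false ∧ M b c = false ∧
    M' = swapEntries M a b c d

omit [Fintype ρ] [Fintype κ] in
-- In a 2×2 submatrix with equal entries along each diagonal, exchanging the columns has the same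
-- effect as exchanging the rows.
theorem transpose_swapEntries {M : Matrix ρ κ Bool} {a b : ρ} {c d : κ} (h : M a c = M b d)
    (h' : M a d = M b c) (hab : a ≠ b) :
    (swapEntries M a b c d).transpose = swapEntries M.transpose c d a b := by
  ext j i
  simp only [Matrix.transpose_apply, swapEntries, Equiv.swap_apply_def]
  by_cases h1 : i = a
  · subst h1
    by_cases h3 : j = c
    · subst h3
      simp [h']
    by_cases h4 : j = d
    · subst h4
      simp [h3, h]
    simp [h3, h4]
  by_cases h2 : i = b
  · subst h2
    by_cases h3 : j = c
    · subst h3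
      simp [h1, h]
    by_cases h4 : j = d
    · subst h4
      simp [h1, h3, h']
    simp [h3, h4]
  simp [h1, h2]

omit [Fintype ρ] [Fintype κ] in
theorem swapEntries_swapEntries (M : Matrix ρ κ Bool) (a b : ρ) (c d : κ) :
    swapEntries (swapEntries M a b c d) a b c d = M := by
  ext i j
  by_cases h : i = a ∨ i = b <;> simp [swapEntries, h]

omit [Fintype ρ] [Fintype κ] in
theorem swapEntries_comm (M : Matrix ρ κ Bool) (a b : ρ) (c d : κ) :
    swapEntries M a b d c = swapEntries M a b c d := by
  ext i j
  simp [swapEntries, Equiv.swap_comm]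

omit [Fintype ρ] [Fintype κ] in
theorem IsSwap.symm {R : ρ → ρ → κ → κ → Prop} (hR : ∀ a b c d, R a b c d → R a b d c)
    {M M' : Matrix ρ κ Bool} (h : IsSwap R M M') : IsSwap R M' M := by
  obtain ⟨a, b, c, d, h0, h1, h2, h3, h4, rfl⟩ := h
  refine ⟨a, b, d, c, hR _ _ _ _ h0, ?_, ?_, ?_, ?_, ?_⟩
  · simpa [swapEntries] using h1
  · simpa [swapEntries] using h2
  · simpa [swapEntries] using h3
  · simpa [swapEntries] using h4
  · rw [swapEntries_comm, swapEntries_swapEntries]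

omit [Fintype ρ] [Fintype κ] in
theorem IsSwap.mono {R R' : ρ → ρ → κ → κ → Prop} (hR : ∀ a b c d, R a b c d → R' a b c d)
    {M M' : Matrix ρ κ Bool} (h : IsSwap R M M') : IsSwap R' M M' := by
  obtain ⟨a, b, c, d, h0, h⟩ := h
  exact ⟨a, b, c, d, hR _ _ _ _ h0, h⟩

omit [Fintype ρ] [Fintype κ] in
theorem IsSwap.transpose {R : ρ → ρ → κ → κ → Prop} {M M' : Matrix ρ κ Bool}
    (h : IsSwap R M M') :
    IsSwap (fun c d a b => R a b c d) M.transpose M'.transpose := by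
  obtain ⟨a, b, c, d, h0, h1, h2, h3, h4, rfl⟩ := h
  refine ⟨c, d, a, b, h0, h1, h2, h4, h3, ?_⟩
  exact transpose_swapEntries (h1.trans h2.symm) (h3.trans h4.symm) (by rintro rfl; simp_all)

/-- The number of ones of row `a` in the columns with label `k`. -/
def rowSpec (g : κ → γ) (M : Matrix ρ κ Bool) (a : ρ) (k : γ) : ℕ :=
  (Finset.univ.filter fun c => g c = k ∧ M a c = true).card

/-- A one moves from column `c` to column `d`, so one unit passes from the label of `c` to that of
`d`. The additive form avoids truncated subtraction and covers equal labels. -/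
theorem card_filter_swap (g : κ → γ) {u : κ → Bool} {c d : κ} (hc : u c = true)
    (hd : u d = false) (k : γ) :
    (Finset.univ.filter fun x => g x = k ∧ u (Equiv.swap c d x) = true).card +
        (if g c = k then 1 else 0) =
      (Finset.univ.filter fun x => g x = k ∧ u x = true).card + (if g d = k then 1 else 0) := by
  have hcd : d ≠ c := by rintro rfl; simp_all
  have hd' : d ∈ Finset.univ.erase c := by simp [hcd]
  simp only [Finset.card_filter]
  rw [← Finset.add_sum_erase _ _ (Finset.mem_univ c), ← Finset.add_sum_erase _ _ hd',
    ← Finset.add_sum_erase _ _ (Finset.mem_univ c), ← Finset.add_sum_erase _ _ hd']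
  have : ∀ x ∈ (Finset.univ.erase c).erase d,
      (if g x = k ∧ u (Equiv.swap c d x) = true then 1 else 0) =
        if g x = k ∧ u x = true then 1 else 0 := by
    intro x hx
    simp only [Finset.mem_erase] at hx
    rw [Equiv.swap_apply_of_ne_of_ne hx.2.1 hx.1]
  rw [Finset.sum_congr rfl this]
  simp [hc, hd]
  omega

omit [Fintype ρ] in
theorem rowSpec_swapEntries (g : κ → γ) {M : Matrix ρ κ Bool} {a b : ρ} {c d : κ}
    (h1 : M a c = true) (h2 : M b d = true) (h3 : M a d = false) (h4 : M b c = false)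
    (x : ρ) (k : γ) :
    rowSpec g (swapEntries M a b c d) x k +
        (if x = a then if g c = k then 1 else 0 else if x = b then if g d = k then 1 else 0 else 0) =
      rowSpec g M x k +
        (if x = a then if g d = k then 1 else 0 else if x = b then if g c = k then 1 else 0 else 0) := by
  have hab : b ≠ a := by rintro rfl; simp_all
  by_cases hx : x = a
  · subst hx
    simpa [rowSpec, swapEntries] using card_filter_swap g h1 h3 k
  by_cases hx' : x = b
  · subst hx'
    have := card_filter_swap g h2 h4 k
    rw [Equiv.swap_comm] at this
    simpa [rowSpec, swapEntries, hab] using this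
  · simp [rowSpec, swapEntries, hx, hx']

omit [Fintype ρ] in
theorem IsSwap.rowSpec_eq {R : ρ → ρ → κ → κ → Prop} {g : κ → γ}
    (hR : ∀ a b c d, R a b c d → g c = g d) {M M' : Matrix ρ κ Bool} (h : IsSwap R M M') :
    rowSpec g M' = rowSpec g M := by
  obtain ⟨a, b, c, d, h0, h1, h2, h3, h4, rfl⟩ := h
  ext x k
  have := rowSpec_swapEntries g h1 h2 h3 h4 x k
  rw [hR _ _ _ _ h0] at this
  omega

omit [Fintype κ] in
theorem IsSwap.colSpec_eq {R : ρ → ρ → κ → κ → Prop} {f : ρ → δ}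
    (hR : ∀ a b c d, R a b c d → f a = f b) {M M' : Matrix ρ κ Bool} (h : IsSwap R M M') :
    rowSpec f M'.transpose = rowSpec f M.transpose :=
  h.transpose.rowSpec_eq fun c d a b => hR a b c d

omit [Fintype ρ] [DecidableEq κ] [DecidableEq ρ] in
theorem rowSum_eq_rowSpec (M : Matrix ρ κ Bool) (a : ρ) :
    rowSum M a = rowSpec (fun _ => ()) M a () := by
  simp [rowSum, rowSpec]

omit [Fintype ρ] [DecidableEq κ] [DecidableEq ρ] in
theorem sum_rowSpec [Fintype γ] (g : κ → γ) (M : Matrix ρ κ Bool) (a : ρ) :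
    ∑ k, rowSpec g M a k = rowSum M a := by
  rw [rowSum, Finset.card_eq_sum_card_fiberwise (f := g) (t := Finset.univ) (by simp)]
  refine Finset.sum_congr rfl fun k _ => ?_
  rw [rowSpec, Finset.filter_filter]
  simp only [and_comm]

omit [Fintype ρ] in
theorem IsSwap.rowSum_eq {R : ρ → ρ → κ → κ → Prop} {M M' : Matrix ρ κ Bool}
    (h : IsSwap R M M') (a : ρ) : rowSum M' a = rowSum M a := by
  rw [rowSum_eq_rowSpec, rowSum_eq_rowSpec, h.rowSpec_eq]
  simp

omit [Fintype κ] in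
theorem IsSwap.colSum_eq {R : ρ → ρ → κ → κ → Prop} {M M' : Matrix ρ κ Bool}
    (h : IsSwap R M M') (c : κ) : colSum M' c = colSum M c :=
  h.transpose.rowSum_eq c

theorem card_filter_and {α : Type*} [Fintype α] (p : α → Prop) [DecidablePred p] (u : α → Bool) :
    (Finset.univ.filter fun x => p x ∧ u x = true).card =
      ∑ x, if p x then if u x = true then 1 else 0 else 0 := by
  simp only [Finset.card_filter, ite_and]

theorem card_filter_mem_add {α : Type*} [Fintype α] [DecidableEq α] (s : Finset α) (p : α → Prop)
    [DecidablePred p] (u : α → Bool) :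
    (Finset.univ.filter fun x => (x ∈ s ∧ p x) ∧ u x = true).card +
        (Finset.univ.filter fun x => (x ∉ s ∧ p x) ∧ u x = true).card =
      (Finset.univ.filter fun x => p x ∧ u x = true).card := by
  rw [← Finset.card_filter_add_card_filter_not (s := Finset.univ.filter fun x => p x ∧ u x = true)
    (fun x => x ∈ s), Finset.filter_filter, Finset.filter_filter]
  congr 3 <;> ext x <;> tauto

omit [DecidableEq κ] [DecidableEq ρ] in
-- Double counting of the ones in the block of rows labelled `i` and columns labelled `k`.
theorem sum_rowSpec_eq_sum_colSpec (f : ρ → δ) (g : κ → γ) (M : Matrix ρ κ Bool) (i : δ)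
    (k : γ) :
    ∑ a with f a = i, rowSpec g M a k = ∑ c with g c = k, rowSpec f M.transpose c i := by
  simp only [rowSpec, Finset.card_filter, Finset.sum_filter, Matrix.transpose_apply, ite_and]
  calc _ = ∑ a, ∑ c, if f a = i then if g c = k then if M a c = true then 1 else 0 else 0 else 0 := by
        refine Finset.sum_congr rfl fun a _ => ?_
        by_cases h : f a = i <;> simp [h]
    _ = _ := by
        rw [Finset.sum_comm]
        refine Finset.sum_congr rfl fun c _ => ?_
        by_cases h : g c = k
        · simp only [h, if_true]
          exact (card_filter_and (fun x => f x = i) fun x => M x c).symm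
        · simp [h]

/-- Matrices with the same row and column spectra are connected by swaps within blocks. -/
theorem reflTransGen_of_spec_eq_aux (f : ρ → δ) (g : κ → γ) (S : Finset ρ) :
    ∀ M N : Matrix ρ κ Bool, (∀ a ∉ S, ∀ c, M a c = N a c) → rowSpec g M = rowSpec g N →
      rowSpec f M.transpose = rowSpec f N.transpose →
      Relation.ReflTransGen (IsSwap fun a b c d => f a = f b ∧ g c = g d) M N := by
  induction S using Finset.induction_on with
  | empty =>
    intro M N h _ _
    rw [show M = N from Matrix.ext fun a c => h a (by simp) c]
  | insert a S ha ihS =>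
    -- Inner induction on the number of columns in which row `a` of `M` and of `N` disagree; once it
    -- is zero, row `a` can be dropped.
    suffices ∀ n, ∀ M N : Matrix ρ κ Bool, (Finset.univ.filter fun c => M a c ≠ N a c).card = n →
        (∀ x ∉ insert a S, ∀ c, M x c = N x c) → rowSpec g M = rowSpec g N →
        rowSpec f M.transpose = rowSpec f N.transpose →
        Relation.ReflTransGen (IsSwap fun a b c d => f a = f b ∧ g c = g d) M N from
      fun M N => this _ M N rfl
    intro n
    induction n using Nat.strong_induction_on with
    | _ n ihn =>
    intro M N hn hoff hrow hcol
    by_cases hagree : ∀ c, M a c = N a c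
    · refine ihS M N (fun x hx c => ?_) hrow hcol
      by_cases hxa : x = a
      · rw [hxa, hagree]
      · exact hoff x (by simp [hx, hxa]) c
    -- Row `a` has equally many ones in each column class of both matrices, so disagreements of both
    -- kinds occur in the same class.
    have hpair : ∃ c d, g c = g d ∧ M a c = true ∧ N a c = false ∧ M a d = false ∧
        N a d = true := by
      push Not at hagree
      obtain ⟨c, hc⟩ := hagree
      have hk : (Finset.univ.filter fun x => g x = g c ∧ M a x = true).card =
          (Finset.univ.filter fun x => g x = g c ∧ N a x = true).card :=
        congrFun (congrFun hrow a) (g c)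
      cases hM : M a c <;> cases hN : N a c
      · simp_all
      · obtain ⟨d, h1, h2, h3⟩ := exists_of_card_le (p := fun x => g x = g c) hk.ge rfl hN hM
        exact ⟨d, c, h1, h2, h3, hM, hN⟩
      · obtain ⟨d, h1, h2, h3⟩ := exists_of_card_le (p := fun x => g x = g c) hk.le rfl hM hN
        exact ⟨c, d, h1.symm, hM, hN, h3, h2⟩
      · simp_all
    obtain ⟨c, d, hg, hMc, hNc, hMd, hNd⟩ := hpair
    have hcd : c ≠ d := by rintro rfl; simp_all
    -- The column spectra agree and so do the finished rows, hence the counts over unfinished rows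
    -- agree. This lets the partner row be chosen among unfinished rows.
    have hcount : ∀ x, (Finset.univ.filter fun b =>
          (b ∈ insert a S ∧ f b = f a) ∧ M b x = true).card =
        (Finset.univ.filter fun b => (b ∈ insert a S ∧ f b = f a) ∧ N b x = true).card := by
      intro x
      have key : ∀ L : Matrix ρ κ Bool, (Finset.univ.filter fun b =>
          (b ∈ insert a S ∧ f b = f a) ∧ L b x = true).card + (Finset.univ.filter fun b =>
          (b ∉ insert a S ∧ f b = f a) ∧ L b x = true).card =
            rowSpec f L.transpose x (f a) :=
        fun L => card_filter_mem_add (insert a S) (fun b => f b = f a) (fun b => L b x)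
      have h1 := key M
      have h2 := key N
      rw [hcol] at h1
      have h3 : (Finset.univ.filter fun b => (b ∉ insert a S ∧ f b = f a) ∧ M b x = true) =
          (Finset.univ.filter fun b => (b ∉ insert a S ∧ f b = f a) ∧ N b x = true) := by
        refine Finset.filter_congr fun b _ => and_congr_right fun hb => ?_
        rw [hoff b hb.1]
      rw [h3] at h1
      omega
    have hlt : ∀ (M N : Matrix ρ κ Bool), M a c ≠ N a c → M a d ≠ N a d → M a c ≠ M a d →
        ∀ b, (Finset.univ.filter fun x => swapEntries M a b c d a x ≠ N a x).card <
          (Finset.univ.filter fun x => M a x ≠ N a x).card := by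
      intro M N h1 h2 h3 b
      refine Finset.card_lt_card ?_
      rw [Finset.ssubset_iff_of_subset]
      · refine ⟨c, by simp [h1], ?_⟩
        simp [swapEntries]
        revert h1 h3
        cases M a c <;> cases M a d <;> cases N a c <;> simp
      intro x hx
      simp only [Finset.mem_filter, Finset.mem_univ, true_and, swapEntries, true_or, if_true]
        at hx ⊢
      by_cases hxc : x = c
      · rwa [hxc]
      by_cases hxd : x = d
      · rwa [hxd]
      rwa [Equiv.swap_apply_of_ne_of_ne hxc hxd] at hx
    have hsw_off : ∀ (L : Matrix ρ κ Bool) b, b ∈ insert a S → ∀ x ∉ insert a S, ∀ y,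
        swapEntries L a b c d x y = L x y := by
      intro L b hb x hx y
      have h1 : x ≠ a := by rintro rfl; simp at hx
      have h2 : x ≠ b := by rintro rfl; exact hx hb
      simp [swapEntries, h1, h2]
    have hsymm : ∀ {L L' : Matrix ρ κ Bool},
        IsSwap (fun a b c d => f a = f b ∧ g c = g d) L L' →
        IsSwap (fun a b c d => f a = f b ∧ g c = g d) L' L :=
      fun h => h.symm fun a b c d h => ⟨h.1, h.2.symm⟩
    -- If column `c` has no more ones than `d` in the unfinished rows of the class, `M` has a
    -- partner row for a swap that corrects row `a`. Otherwise the same comparison, transferred to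
    -- `N` by `hcount`, gives a partner in `N`, and the last step of the path is a swap there.
    rcases le_total
      (Finset.univ.filter fun b => (b ∈ insert a S ∧ f b = f a) ∧ M b c = true).card
      (Finset.univ.filter fun b => (b ∈ insert a S ∧ f b = f a) ∧ M b d = true).card with hle | hle
    · obtain ⟨b, ⟨hbS, hb⟩, hbd, hbc⟩ := exists_of_card_le
        (p := fun b => b ∈ insert a S ∧ f b = f a) (u := fun b => M b c) (v := fun b => M b d) hle
        ⟨Finset.mem_insert_self _ _, rfl⟩ hMc hMd
      have hsw : IsSwap (fun a b c d => f a = f b ∧ g c = g d) M (swapEntries M a b c d) :=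
        ⟨a, b, c, d, ⟨hb.symm, hg⟩, hMc, hbd, hMd, hbc, rfl⟩
      refine Relation.ReflTransGen.head hsw (ihn _ ?_ _ _ rfl ?_ ?_ ?_)
      · rw [← hn]
        exact hlt M N (by simp [hMc, hNc]) (by simp [hMd, hNd]) (by simp [hMc, hMd]) b
      · intro x hx y
        rw [hsw_off M b hbS x hx y, hoff x hx y]
      · rw [hsw.rowSpec_eq fun _ _ _ _ h => h.2, hrow]
      · rw [hsw.colSpec_eq fun _ _ _ _ h => h.1, hcol]
    · rw [hcount, hcount] at hle
      obtain ⟨b, ⟨hbS, hb⟩, hbc, hbd⟩ := exists_of_card_le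
        (p := fun b => b ∈ insert a S ∧ f b = f a) (u := fun b => N b d) (v := fun b => N b c) hle
        ⟨Finset.mem_insert_self _ _, rfl⟩ hNd hNc
      have hsw : IsSwap (fun a b c d => f a = f b ∧ g c = g d) N (swapEntries N a b c d) :=
        ⟨a, b, d, c, ⟨hb.symm, hg.symm⟩, hNd, hbc, hNc, hbd, by rw [swapEntries_comm]⟩
      refine Relation.ReflTransGen.tail (ihn _ ?_ _ _ rfl ?_ ?_ ?_) (hsymm hsw)
      · rw [← hn]
        simpa only [ne_comm] using
          hlt N M (by simp [hMc, hNc]) (by simp [hMd, hNd]) (by simp [hNc, hNd]) b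
      · intro x hx y
        rw [hsw_off N b hbS x hx y, hoff x hx y]
      · rw [hsw.rowSpec_eq fun _ _ _ _ h => h.2, hrow]
      · rw [hsw.colSpec_eq fun _ _ _ _ h => h.1, hcol]

theorem reflTransGen_of_spec_eq (f : ρ → δ) (g : κ → γ) {M N : Matrix ρ κ Bool}
    (hrow : rowSpec g M = rowSpec g N) (hcol : rowSpec f M.transpose = rowSpec f N.transpose) :
    Relation.ReflTransGen (IsSwap fun a b c d => f a = f b ∧ g c = g d) M N :=
  reflTransGen_of_spec_eq_aux f g Finset.univ M N (by simp) hrow hcol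

/-! ### Balancing the spectra -/

omit [Fintype ρ] [DecidableEq δ] in
-- A surplus of row `a` at label `k` yields a column where `a` has a one and `b` a zero; the surplus
-- of `b` at `j` yields the opposite pattern. Swapping these columns trades one unit of `k` for one
-- of `j`.
theorem exists_swap_of_rowSpec_lt {f : ρ → δ} {g : κ → γ} {M : Matrix ρ κ Bool} {a b : ρ}
    {k j : γ} (hab : f a = f b) (hk : rowSpec g M b k < rowSpec g M a k)
    (hj : rowSpec g M a j < rowSpec g M b j) :
    ∃ M', IsSwap (fun a b _ _ => f a = f b) M M' ∧ ∀ x y,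
      rowSpec g M' x y +
        (if x = a then if y = k then 1 else 0 else if x = b then if y = j then 1 else 0 else 0) =
      rowSpec g M x y +
        (if x = a then if y = j then 1 else 0 else if x = b then if y = k then 1 else 0 else 0) := by
  obtain ⟨c, hc, hac, hbc⟩ := exists_of_card_lt (p := fun x => g x = k) hk
  obtain ⟨d, hd, hbd, had⟩ := exists_of_card_lt (p := fun x => g x = j) hj
  refine ⟨_, ⟨a, b, c, d, hab, hac, hbd, had, hbc, rfl⟩, fun x y => ?_⟩
  have := rowSpec_swapEntries g hac hbd had hbc x y
  simpa only [hc, hd, eq_comm (a := y)] using this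

/-- Closing a gap of at least two at `k` lowers the sum of squares by at least 2; the return unit at
`j` goes from the larger to the smaller entry and does not raise it. -/
theorem sum_sq_lt {α : Type*} [Fintype α] [DecidableEq α] [Fintype γ] {s s' : α → γ → ℕ}
    {a b : α} {k j : γ} (hab : a ≠ b) (hkj : k ≠ j) (hk : s b k + 2 ≤ s a k) (hj : s a j < s b j)
    (h : ∀ x y, s' x y +
        (if x = a then if y = k then 1 else 0 else if x = b then if y = j then 1 else 0 else 0) =
      s x y +
        (if x = a then if y = j then 1 else 0 else if x = b then if y = k then 1 else 0 else 0)) :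
    ∑ x, ∑ y, s' x y ^ 2 < ∑ x, ∑ y, s x y ^ 2 := by
  have h' : ∀ x y, (s' x y : ℤ) ^ 2 = (s x y : ℤ) ^ 2 +
      (if x = a then (if y = j then 2 * (s a j : ℤ) + 1 else 0) +
        (if y = k then -2 * (s a k : ℤ) + 1 else 0) else 0) +
      (if x = b then (if y = k then 2 * (s b k : ℤ) + 1 else 0) +
        (if y = j then -2 * (s b j : ℤ) + 1 else 0) else 0) := by
    intro x y
    have e := h x y
    zify at e
    have e' := eq_sub_of_add_eq e
    rw [e']
    by_cases h1 : x = a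
    · subst h1
      by_cases h3 : y = k
      · subst h3
        simp [hab, hkj]
        ring
      by_cases h4 : y = j
      · subst h4
        simp [hab, h3]
        ring
      simp [hab, h3, h4]
    by_cases h2 : x = b
    · subst h2
      by_cases h3 : y = k
      · subst h3
        simp [h1, hkj]
        ring
      by_cases h4 : y = j
      · subst h4
        simp [h1, h3]
        ring
      simp [h1, h3, h4]
    simp [h1, h2]
  zify
  simp only [h', Finset.sum_add_distrib]
  have e1 : ∀ (z : α) (u v : ℤ), ∑ x : α, ∑ y : γ, (if x = z then (if y = j then u else 0) +
      (if y = k then v else 0) else 0) = u + v := by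
    intro z u v
    rw [Finset.sum_eq_single z (fun x _ hx => by simp [hx]) (by simp)]
    simp [Finset.sum_add_distrib]
  have e2 : ∀ (z : α) (u v : ℤ), ∑ x : α, ∑ y : γ, (if x = z then (if y = k then u else 0) +
      (if y = j then v else 0) else 0) = u + v := by
    intro z u v
    rw [Finset.sum_eq_single z (fun x _ hx => by simp [hx]) (by simp)]
    simp [Finset.sum_add_distrib]
  rw [e1, e2]
  zify at hk hj
  linarith

/-- By swaps between rows with the same label, the row spectra can be balanced. -/
theorem exists_balanced [Fintype γ] (f : ρ → δ) (g : κ → γ) (M : Matrix ρ κ Bool)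
    (hf : ∀ a b, f a = f b → rowSum M a = rowSum M b) :
    ∃ M', Relation.ReflTransGen (IsSwap fun a b _ _ => f a = f b) M M' ∧
      ∀ a b k, f a = f b → rowSpec g M' a k ≤ rowSpec g M' b k + 1 := by
  induction hn : ∑ x, ∑ y, rowSpec g M x y ^ 2 using Nat.strong_induction_on generalizing M with
  | _ n ih =>
  by_cases hbal : ∀ a b k, f a = f b → rowSpec g M a k ≤ rowSpec g M b k + 1
  · exact ⟨M, .refl, hbal⟩
  push Not at hbal
  obtain ⟨a, b, k, hab, hk⟩ := hbal
  -- Both rows have the same sum, so the surplus of `a` at `k` is compensated at some other label.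
  have hj : ∃ j, rowSpec g M a j < rowSpec g M b j := by
    by_contra! hc
    have h1 : ∑ j, rowSpec g M b j < ∑ j, rowSpec g M a j :=
      Finset.sum_lt_sum (fun j _ => hc j) ⟨k, Finset.mem_univ k, by omega⟩
    rw [sum_rowSpec, sum_rowSpec, hf a b hab] at h1
    exact lt_irrefl _ h1
  obtain ⟨j, hj⟩ := hj
  obtain ⟨M', hsw, hM'⟩ := exists_swap_of_rowSpec_lt (k := k) hab (by omega) hj
  have hne : a ≠ b := by rintro rfl; omega
  have hkj : k ≠ j := by rintro rfl; omega
  have hlt := sum_sq_lt hne hkj (by omega) hj hM'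
  obtain ⟨N, hN, hb⟩ := ih _ (hn ▸ hlt) M'
    (fun a b h => by rw [hsw.rowSum_eq, hsw.rowSum_eq, hf a b h]) rfl
  exact ⟨N, .head hsw hN, hb⟩

/-- Integers that differ pairwise by at most one take only the values floor of the mean and that
floor plus one. -/
theorem eq_div_add_of_balanced {α : Type*} {s : Finset α} {v : α → ℕ}
    (h : ∀ x ∈ s, ∀ y ∈ s, v x ≤ v y + 1) {a : α} (ha : a ∈ s) :
    v a = (∑ x ∈ s, v x) / s.card + (decide ((∑ x ∈ s, v x) / s.card < v a)).toNat := by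
  have hpos : 0 < s.card := Finset.card_pos.2 ⟨a, ha⟩
  have h1 : v a ≤ (∑ x ∈ s, v x) / s.card + 1 := by
    rw [← Nat.sub_le_iff_le_add, Nat.le_div_iff_mul_le hpos, mul_comm, ← smul_eq_mul]
    exact Finset.card_nsmul_le_sum _ _ _ fun y hy => by have := h a ha y hy; omega
  have h2 : (∑ x ∈ s, v x) / s.card < v a + 1 := by
    rw [Nat.div_lt_iff_lt_mul hpos, mul_comm, ← smul_eq_mul, ← Finset.sum_const]
    exact Finset.sum_lt_sum (fun y hy => h y hy a ha) ⟨a, ha, by omega⟩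
  by_cases h3 : (∑ x ∈ s, v x) / s.card < v a <;> simp [h3] <;> omega

omit [Fintype ρ] [Fintype κ] in
theorem reflTransGen_isSwap_symm {R : ρ → ρ → κ → κ → Prop}
    (hR : ∀ a b c d, R a b c d → R a b d c) {M M' : Matrix ρ κ Bool}
    (h : Relation.ReflTransGen (IsSwap R) M M') : Relation.ReflTransGen (IsSwap R) M' M :=
  haveI : Std.Symm (IsSwap R) := ⟨fun _ _ h => h.symm hR⟩
  Std.Symm.symm _ _ h

omit [Fintype ρ] [DecidableEq δ] in
/-- Swaps on the binary parts of the row spectra lift to swaps between rows. -/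
theorem exists_lift (f : ρ → δ) (g : κ → γ) [Fintype γ] (q : δ → γ → ℕ) {M : Matrix ρ κ Bool}
    {t t' : Matrix ρ γ Bool} (ht : ∀ a k, rowSpec g M a k = q (f a) k + (t a k).toNat)
    (h : Relation.ReflTransGen (IsSwap fun a b (_ _ : γ) => f a = f b ∧ () = ()) t t') :
    ∃ M', Relation.ReflTransGen (IsSwap fun a b _ _ => f a = f b) M M' ∧
      ∀ a k, rowSpec g M' a k = q (f a) k + (t' a k).toNat := by
  induction h with
  | refl => exact ⟨M, .refl, ht⟩
  | tail _ hsw ih =>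
    obtain ⟨M₁, hM₁, hs⟩ := ih
    obtain ⟨a, b, k, j, ⟨hab, -⟩, h1, h2, h3, h4, rfl⟩ := hsw
    obtain ⟨M₂, hM₂, hs₂⟩ := exists_swap_of_rowSpec_lt (f := f) (g := g) (M := M₁) (a := a)
      (b := b) (k := k) (j := j) hab (by rw [hs, hs, h1, h4, hab]; simp)
      (by rw [hs, hs, h2, h3, hab]; simp)
    refine ⟨M₂, hM₁.tail hM₂, fun x y => ?_⟩
    have e := hs₂ x y
    rw [hs] at e
    have hba : b ≠ a := by rintro rfl; simp_all
    have hkj : k ≠ j := by rintro rfl; simp_all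
    by_cases hx : x = a
    · subst hx
      by_cases hk : y = k
      · subst hk
        simp [swapEntries, h1, h3, hkj] at e ⊢
        omega
      by_cases hj : y = j
      · subst hj
        simp [swapEntries, h1, h3, hkj.symm] at e ⊢
        omega
      simp [swapEntries, hk, hj, Equiv.swap_apply_of_ne_of_ne] at e ⊢
      omega
    by_cases hx' : x = b
    · subst hx'
      by_cases hk : y = k
      · subst hk
        simp [swapEntries, h2, h4, hkj, hx] at e ⊢
        omega
      by_cases hj : y = j
      · subst hj
        simp [swapEntries, h2, h4, hkj.symm, hx] at e ⊢
        omega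
      simp [swapEntries, hk, hj, hx, Equiv.swap_apply_of_ne_of_ne] at e ⊢
      omega
    simp [swapEntries, hx, hx'] at e ⊢
    omega

/-- By swaps between rows with the same label, the row spectra of two matrices with the same
row sums and the same joint degrees can be made equal. -/
theorem exists_rowSpec_eq [Fintype γ] (f : ρ → δ) (g : κ → γ) {M N : Matrix ρ κ Bool}
    (hf : ∀ a b, f a = f b → rowSum M a = rowSum M b) (hMN : ∀ a, rowSum M a = rowSum N a)
    (hJ : ∀ i k, ∑ a with f a = i, rowSpec g M a k = ∑ a with f a = i, rowSpec g N a k) :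
    ∃ M' N', Relation.ReflTransGen (IsSwap fun a b _ _ => f a = f b) M M' ∧
      Relation.ReflTransGen (IsSwap fun a b _ _ => f a = f b) N N' ∧
      rowSpec g M' = rowSpec g N' := by
  have hinv : ∀ {L L' : Matrix ρ κ Bool},
      Relation.ReflTransGen (IsSwap fun a b _ _ => f a = f b) L L' →
      (∀ a, rowSum L' a = rowSum L a) ∧
        rowSpec f L'.transpose = rowSpec f L.transpose := by
    intro L L' h
    induction h with
    | refl => exact ⟨fun _ => rfl, rfl⟩
    | tail _ hs ih =>
      exact ⟨fun a => (hs.rowSum_eq a).trans (ih.1 a),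
        (hs.colSpec_eq fun _ _ _ _ h => h).trans ih.2⟩
  obtain ⟨M₁, hM₁, hbM⟩ := exists_balanced f g M hf
  obtain ⟨N₁, hN₁, hbN⟩ := exists_balanced f g N (by simpa [hMN] using hf)
  have hJ₁ : ∀ i k, ∑ a with f a = i, rowSpec g M₁ a k = ∑ a with f a = i, rowSpec g N₁ a k := by
    intro i k
    rw [sum_rowSpec_eq_sum_colSpec f g M₁, sum_rowSpec_eq_sum_colSpec f g N₁, (hinv hM₁).2,
      (hinv hN₁).2, ← sum_rowSpec_eq_sum_colSpec f g M, ← sum_rowSpec_eq_sum_colSpec f g N, hJ]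
  have hsum₁ : ∀ a, ∑ k, rowSpec g M₁ a k = ∑ k, rowSpec g N₁ a k := by
    intro a
    rw [sum_rowSpec, sum_rowSpec, (hinv hM₁).1, (hinv hN₁).1, hMN]
  -- By `hJ₁` the same quotient serves `N₁`, so the two spectra differ only in their 0-1 residuals.
  set q : δ → γ → ℕ := fun i k =>
    (∑ a with f a = i, rowSpec g M₁ a k) / (Finset.univ.filter fun a => f a = i).card with hq
  let t : Matrix ρ κ Bool → Matrix ρ γ Bool := fun L a k => decide (q (f a) k < rowSpec g L a k)
  have htM : ∀ a k, rowSpec g M₁ a k = q (f a) k + (t M₁ a k).toNat := by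
    intro a k
    exact eq_div_add_of_balanced (s := Finset.univ.filter fun b => f b = f a)
      (v := fun a => rowSpec g M₁ a k)
      (fun x hx y hy => hbM x y k
        (by rw [(Finset.mem_filter.1 hx).2, (Finset.mem_filter.1 hy).2])) (by simp)
  have htN : ∀ a k, rowSpec g N₁ a k = q (f a) k + (t N₁ a k).toNat := by
    intro a k
    simp only [t, hq, hJ₁]
    exact eq_div_add_of_balanced (s := Finset.univ.filter fun b => f b = f a)
      (v := fun a => rowSpec g N₁ a k)
      (fun x hx y hy => hbN x y k
        (by rw [(Finset.mem_filter.1 hx).2, (Finset.mem_filter.1 hy).2])) (by simp)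
  have htoNat : ∀ b : Bool, b.toNat = if b = true then 1 else 0 := by decide
  -- The residuals have equal row sums and equal class-wise column sums, so block connectivity
  -- applies with all columns in one class.
  have hpath : Relation.ReflTransGen (IsSwap fun a b (_ _ : γ) => f a = f b ∧ () = ())
      (t M₁) (t N₁) := by
    refine reflTransGen_of_spec_eq f (fun _ => ()) ?_ ?_
    · ext a _
      have h := hsum₁ a
      simp only [htM, htN, Finset.sum_add_distrib, add_right_inj, htoNat] at h
      simpa only [rowSpec, Finset.card_filter, true_and] using h
    · ext k i
      have h := hJ₁ i k
      have e : ∀ L : Matrix ρ κ Bool, (∀ a k, rowSpec g L a k = q (f a) k + (t L a k).toNat) →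
          ∑ a with f a = i, rowSpec g L a k =
            ∑ a with f a = i, q (f a) k + rowSpec f (t L).transpose k i := by
        intro L hL
        simp only [hL, Finset.sum_add_distrib, htoNat]
        rw [← Finset.card_filter, Finset.filter_filter]
        rfl
      rw [e _ htM, e _ htN] at h
      omega
  obtain ⟨M₂, hM₂, hs⟩ := exists_lift f g q htM hpath
  refine ⟨M₂, N₁, hM₁.trans hM₂, hN₁, ?_⟩
  ext a k
  rw [hs, htN]

/-- Matrices with the same row sums, column sums and joint degrees are connected by swaps
between rows with the same label or between columns with the same label. -/
theorem reflTransGen_of_joint_eq [Fintype δ] [Fintype γ] (f : ρ → δ) (g : κ → γ)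
    {M N : Matrix ρ κ Bool}
    (hf : ∀ a b, f a = f b → rowSum M a = rowSum M b) (hrow : ∀ a, rowSum M a = rowSum N a)
    (hg : ∀ c d, g c = g d → colSum M c = colSum M d) (hcol : ∀ c, colSum M c = colSum N c)
    (hJ : ∀ i k, ∑ a with f a = i, rowSpec g M a k = ∑ a with f a = i, rowSpec g N a k) :
    Relation.ReflTransGen (IsSwap fun a b c d => f a = f b ∨ g c = g d) M N := by
  have hinv : ∀ {L L' : Matrix ρ κ Bool},
      Relation.ReflTransGen (IsSwap fun a b _ _ => f a = f b) L L' →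
      (∀ c, colSum L' c = colSum L c) ∧ rowSpec f L'.transpose = rowSpec f L.transpose := by
    intro L L' h
    induction h with
    | refl => exact ⟨fun _ => rfl, rfl⟩
    | tail _ hs ih =>
      exact ⟨fun a => (hs.colSum_eq a).trans (ih.1 a),
        (hs.colSpec_eq fun _ _ _ _ h => h).trans ih.2⟩
  have hinv' : ∀ {L L' : Matrix ρ κ Bool},
      Relation.ReflTransGen (IsSwap fun _ _ c d => g c = g d) L L' →
      rowSpec g L' = rowSpec g L := by
    intro L L' h
    induction h with
    | refl => rfl
    | tail _ hs ih => exact (hs.rowSpec_eq fun _ _ _ _ h => h).trans ih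
  obtain ⟨M₁, N₁, hM₁, hN₁, hspec⟩ := exists_rowSpec_eq f g hf hrow hJ
  -- The transposed swaps stay within column classes, so they keep the row spectra that have just
  -- been made equal.
  obtain ⟨M₂, N₂, hM₂, hN₂, hspec₂⟩ := exists_rowSpec_eq g f (M := M₁.transpose)
    (N := N₁.transpose)
    (fun c d h => ((hinv hM₁).1 c).trans ((hg c d h).trans ((hinv hM₁).1 d).symm))
    (fun c => ((hinv hM₁).1 c).trans ((hcol c).trans ((hinv hN₁).1 c).symm))
    (fun k i => by
      rw [(hinv hM₁).2, (hinv hN₁).2, ← sum_rowSpec_eq_sum_colSpec,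
        ← sum_rowSpec_eq_sum_colSpec, hJ])
  have hlift : ∀ {L L' : Matrix κ ρ Bool},
      Relation.ReflTransGen (IsSwap fun c d _ _ => g c = g d) L L' →
      Relation.ReflTransGen (IsSwap fun _ _ c d => g c = g d) L.transpose L'.transpose :=
    fun h => Relation.ReflTransGen.lift _ (fun _ _ h => h.transpose) _ _ h
  have hM₂' := hlift hM₂
  have hN₂' := hlift hN₂
  rw [Matrix.transpose_transpose] at hM₂' hN₂'
  have h3 := reflTransGen_of_spec_eq f g (M := M₂.transpose) (N := N₂.transpose)
    (by rw [hinv' hM₂', hinv' hN₂', hspec]) hspec₂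
  have hmono : ∀ {R : ρ → ρ → κ → κ → Prop}, (∀ a b c d, R a b c d → f a = f b ∨ g c = g d) →
      ∀ {L L' : Matrix ρ κ Bool}, Relation.ReflTransGen (IsSwap R) L L' →
        Relation.ReflTransGen (IsSwap fun a b c d => f a = f b ∨ g c = g d) L L' :=
    fun hR _ _ h => Relation.ReflTransGen.mono (fun _ _ h => h.mono hR) _ _ h
  refine (hmono (fun _ _ _ _ h => Or.inl h) hM₁).trans ?_
  refine (hmono (fun _ _ _ _ h => Or.inr h) hM₂').trans ?_
  refine (hmono (fun _ _ _ _ h => Or.inl h.1) h3).trans ?_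
  refine reflTransGen_isSwap_symm (fun _ _ _ _ h => h.imp id Eq.symm) ?_
  exact (hmono (fun _ _ _ _ h => Or.inl h) hN₁).trans (hmono (fun _ _ _ _ h => Or.inr h) hN₂')

end Connectivity

/-! ### The proposal distribution -/

section Proposal

variable {α β : Type*}

theorem uniformDrawOr_of_nonempty {s : Finset α} (h : s.Nonempty) (y : β) (k : α → PMF β) :
    uniformDrawOr s y k = (PMF.uniformOfFinset s h).bind k := by
  rw [uniformDrawOr, dif_pos h]

theorem uniformDrawOr_empty (y : β) (k : α → PMF β) : uniformDrawOr ∅ y k = PMF.pure y := by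
  rw [uniformDrawOr, dif_neg (by simp)]

theorem uniformDrawOr_ne_zero {s : Finset α} {y x : β} {k : α → PMF β} {e : α} (he : e ∈ s)
    (hk : k e x ≠ 0) : uniformDrawOr s y k x ≠ 0 := by
  rw [uniformDrawOr_of_nonempty ⟨e, he⟩, ← PMF.mem_support_iff, PMF.mem_support_bind_iff]
  exact ⟨e, (PMF.mem_support_uniformOfFinset_iff ⟨e, he⟩ e).2 he, hk⟩

theorem of_uniformDrawOr_ne_zero {s : Finset α} {y x : β} {k : α → PMF β}
    (h : uniformDrawOr s y k x ≠ 0) : x = y ∨ ∃ e ∈ s, k e x ≠ 0 := by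
  rcases s.eq_empty_or_nonempty with rfl | hs
  · rw [uniformDrawOr_empty, ← PMF.mem_support_iff, PMF.mem_support_pure_iff] at h
    exact Or.inl h
  · rw [uniformDrawOr_of_nonempty hs, ← PMF.mem_support_iff, PMF.mem_support_bind_iff] at h
    obtain ⟨e, he, hk⟩ := h
    exact Or.inr ⟨e, by simpa using he, hk⟩

theorem uniformDrawOr_pure_apply [DecidableEq β] {s : Finset α} (hs : s.Nonempty) (y : β)
    (F : α → β) (x : β) :
    uniformDrawOr s y (fun e => PMF.pure (F e)) x =
      ((s.filter fun e => F e = x).card : ℝ≥0∞) * (s.card : ℝ≥0∞)⁻¹ := by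
  rw [uniformDrawOr_of_nonempty hs, PMF.bind_apply, tsum_eq_sum (s := s.filter fun e => F e = x)]
  · rw [Finset.sum_congr rfl (g := fun _ => (s.card : ℝ≥0∞)⁻¹)]
    · simp
    · intro e he
      rw [Finset.mem_filter] at he
      rw [PMF.uniformOfFinset_apply_of_mem hs he.1, he.2, PMF.pure_apply_self, mul_one]
  · intro e he
    by_cases hes : e ∈ s
    · rw [PMF.pure_apply_of_ne, mul_zero]
      rintro rfl
      simp [hes] at he
    · rw [PMF.uniformOfFinset_apply_of_notMem hs hes, zero_mul]

theorem weightedDraw_ne_zero {s : Finset α} {w : α → ℕ} (h : ∑ x ∈ s, w x ≠ 0) {x : α}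
    (hx : x ∈ s) (hw : w x ≠ 0) : weightedDraw s w h x ≠ 0 := by
  rw [weightedDraw, PMF.ofFinset_apply, if_pos hx]
  exact ENNReal.div_ne_zero.2 ⟨by exact_mod_cast hw, ENNReal.natCast_ne_top _⟩

variable {ρ κ : Type*} [Fintype ρ] [Fintype κ] [DecidableEq ρ] [DecidableEq κ]

/-- The random swap between the rows `a` and `b`. -/
noncomputable def rowMove (M : Matrix ρ κ Bool) (a b : ρ) : PMF (Matrix ρ κ Bool) :=
  if M a = M b then PMF.pure M
  else uniformDrawOr (swapPairs M a b) M fun e => PMF.pure (swapEntries M a b e.1 e.2)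

/-- The proposal by rows with given sets `A m` of rows to choose from. -/
noncomputable def rowProposalOn (A : ℕ → Finset ρ) (M : Matrix ρ κ Bool) :
    PMF (Matrix ρ κ Bool) :=
  if h : ∑ m ∈ Finset.Icc 1 (Fintype.card κ), (A m).card.choose 2 ≠ 0 then
    (weightedDraw (Finset.Icc 1 (Fintype.card κ)) (fun m => (A m).card.choose 2) h).bind
      fun m => uniformDrawOr (A m).offDiag M fun r => rowMove M r.1 r.2
  else PMF.pure M

theorem rowProposal_eq (M : Matrix ρ κ Bool) : rowProposal M = rowProposalOn (rowsOfSum M) M :=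
  rfl

omit [Fintype ρ] [DecidableEq ρ] [DecidableEq κ] in
theorem mem_swapPairs {M : Matrix ρ κ Bool} {a b : ρ} {e : κ × κ} :
    e ∈ swapPairs M a b ↔ M a e.1 = M b e.2 ∧ M a e.2 = M b e.1 ∧ M a e.1 ≠ M a e.2 := by
  simp [swapPairs]

omit [Fintype ρ] in
theorem mem_swapPairs_swapEntries {M : Matrix ρ κ Bool} {a b : ρ} {c d : κ} {e : κ × κ} :
    e ∈ swapPairs (swapEntries M a b c d) a b ↔
      (Equiv.swap c d e.1, Equiv.swap c d e.2) ∈ swapPairs M a b := by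
  simp [mem_swapPairs, swapEntries]

omit [Fintype ρ] in
-- On the rows `a` and `b` the swap merely relabels the columns, which carries swap pairs to swap
-- pairs.
theorem card_swapPairs_swapEntries (M : Matrix ρ κ Bool) (a b : ρ) (c d : κ) :
    (swapPairs (swapEntries M a b c d) a b).card = (swapPairs M a b).card :=
  Finset.card_equiv ((Equiv.swap c d).prodCongr (Equiv.swap c d))
    fun _ => mem_swapPairs_swapEntries

omit [Fintype ρ] in
theorem exists_of_rowMove_ne_zero {M M' : Matrix ρ κ Bool} {a b : ρ} (h : rowMove M a b M' ≠ 0)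
    (hne : M' ≠ M) :
    M a ≠ M b ∧ ∃ e ∈ swapPairs M a b, M' = swapEntries M a b e.1 e.2 := by
  rw [rowMove] at h
  split_ifs at h with hab
  · rw [← PMF.mem_support_iff, PMF.mem_support_pure_iff] at h
    exact absurd h hne
  · refine ⟨hab, ?_⟩
    obtain h | ⟨e, he, h⟩ := of_uniformDrawOr_ne_zero h
    · exact absurd h hne
    · rw [← PMF.mem_support_iff, PMF.mem_support_pure_iff] at h
      exact ⟨e, he, h⟩

omit [Fintype ρ] in
-- A pair of columns leads from `M` to `M'` exactly when it leads back, because `swapEntries` is an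
-- involution; the denominators agree by `card_swapPairs_swapEntries`.
theorem rowMove_apply_symm_of_ne_zero {M M' : Matrix ρ κ Bool} {a b : ρ}
    (h : rowMove M a b M' ≠ 0) : rowMove M a b M' = rowMove M' a b M := by
  classical
  by_cases hne : M' = M
  · rw [hne]
  obtain ⟨hab, ⟨c, d⟩, he, rfl⟩ := exists_of_rowMove_ne_zero h hne
  set M' := swapEntries M a b c d with hM'
  have hne1 : (swapPairs M a b).Nonempty := ⟨_, he⟩
  have hne2 : (swapPairs M' a b).Nonempty := by
    rw [← Finset.card_pos, card_swapPairs_swapEntries, Finset.card_pos]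
    exact hne1
  have hab' : M' a ≠ M' b := by
    intro hc
    apply hab
    ext j
    have := congrFun hc (Equiv.swap c d j)
    simpa [hM', swapEntries] using this
  rw [rowMove, rowMove, if_neg hab, if_neg hab', uniformDrawOr_pure_apply hne1,
    uniformDrawOr_pure_apply hne2, card_swapPairs_swapEntries]
  congr 3
  ext e
  simp only [Finset.mem_filter]
  constructor
  · rintro ⟨h1, h2⟩
    have h3 : M = swapEntries M' a b e.1 e.2 := by rw [← h2, swapEntries_swapEntries]
    refine ⟨?_, h3.symm⟩
    rw [h3, mem_swapPairs_swapEntries, Equiv.swap_apply_left, Equiv.swap_apply_right] at h1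
    rw [mem_swapPairs] at h1 ⊢
    exact ⟨h1.2.1, h1.1, h1.2.2.symm⟩
  · rintro ⟨h1, h2⟩
    have h3 : M' = swapEntries M a b e.1 e.2 := by rw [← h2, swapEntries_swapEntries]
    refine ⟨?_, h3.symm⟩
    rw [h3, mem_swapPairs_swapEntries, Equiv.swap_apply_left, Equiv.swap_apply_right] at h1
    rw [mem_swapPairs] at h1 ⊢
    exact ⟨h1.2.1, h1.1, h1.2.2.symm⟩

omit [Fintype ρ] in
theorem rowMove_apply_symm (M M' : Matrix ρ κ Bool) (a b : ρ) :
    rowMove M a b M' = rowMove M' a b M := by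
  by_cases h : rowMove M a b M' = 0
  · by_cases h' : rowMove M' a b M = 0
    · rw [h, h']
    · exact (rowMove_apply_symm_of_ne_zero h').symm
  · exact rowMove_apply_symm_of_ne_zero h

theorem pure_apply_symm (x y : α) : PMF.pure x y = PMF.pure y x := by
  by_cases h : x = y
  · rw [h]
  · rw [PMF.pure_apply_of_ne _ _ h, PMF.pure_apply_of_ne _ _ (Ne.symm h)]

theorem uniformDrawOr_apply_symm (s : Finset β) {x y : α} {k : α → β → PMF α}
    (hk : ∀ r, k x r y = k y r x) :
    uniformDrawOr s x (k x) y = uniformDrawOr s y (k y) x := by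
  rcases s.eq_empty_or_nonempty with rfl | hs
  · rw [uniformDrawOr_empty, uniformDrawOr_empty, pure_apply_symm]
  · simp only [uniformDrawOr_of_nonempty hs, PMF.bind_apply, hk]

omit [Fintype ρ] in
theorem rowProposalOn_apply_symm (A : ℕ → Finset ρ) (M M' : Matrix ρ κ Bool) :
    rowProposalOn A M M' = rowProposalOn A M' M := by
  by_cases h : ∑ m ∈ Finset.Icc 1 (Fintype.card κ), (A m).card.choose 2 ≠ 0
  · simp only [rowProposalOn, dif_pos h, PMF.bind_apply]
    refine tsum_congr fun m => congrArg _ ?_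
    exact uniformDrawOr_apply_symm
      (k := fun (M : Matrix ρ κ Bool) (r : ρ × ρ) => rowMove M r.1 r.2) _ fun r => rowMove_apply_symm _ _ _ _
  · simp only [rowProposalOn, dif_neg h, pure_apply_symm]

/-- The sets `A_m` depend on the row sums alone, so both proposals are the same mixture of symmetric
row moves. -/
theorem rowProposal_apply_symm {M M' : Matrix ρ κ Bool} (h : ∀ a, rowSum M a = rowSum M' a) :
    rowProposal M M' = rowProposal M' M := by
  have : rowsOfSum M = rowsOfSum M' := by
    ext m a
    simp [rowsOfSum, h]
  rw [rowProposal_eq, rowProposal_eq, this, rowProposalOn_apply_symm]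

theorem colProposal_apply (M M' : Matrix ρ κ Bool) :
    colProposal M M' = rowProposal M.transpose M'.transpose := by
  rw [colProposal, PMF.map_apply, tsum_eq_single M'.transpose]
  · simp
  · intro N hN
    rw [if_neg]
    rintro rfl
    simp at hN

theorem proposal_apply (M M' : Matrix ρ κ Bool) :
    proposal M M' = 2⁻¹ * rowProposal M M' + 2⁻¹ * rowProposal M.transpose M'.transpose := by
  rw [proposal, PMF.bind_apply, tsum_bool]
  simp [colProposal_apply, add_comm]

theorem proposal_apply_symm {M M' : Matrix ρ κ Bool} (hr : ∀ a, rowSum M a = rowSum M' a)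
    (hc : ∀ c, colSum M c = colSum M' c) : proposal M M' = proposal M' M := by
  rw [proposal_apply, proposal_apply, rowProposal_apply_symm hr,
    rowProposal_apply_symm (M := M.transpose) (M' := M'.transpose) hc]

theorem proposal_ne_zero_iff (M M' : Matrix ρ κ Bool) :
    proposal M M' ≠ 0 ↔ rowProposal M M' ≠ 0 ∨ rowProposal M.transpose M'.transpose ≠ 0 := by
  rw [proposal_apply]
  simp only [ne_eq, add_eq_zero, mul_eq_zero, ENNReal.inv_eq_zero, ENNReal.ofNat_ne_top, false_or]
  tauto

theorem rowProposal_ne_zero {M M' : Matrix ρ κ Bool} {a b : ρ} (hab : a ≠ b)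
    (hsum : rowSum M a = rowSum M b) (hpos : 0 < rowSum M a) (h : rowMove M a b M' ≠ 0) :
    rowProposal M M' ≠ 0 := by
  have hmem : rowSum M a ∈ Finset.Icc 1 (Fintype.card κ) :=
    Finset.mem_Icc.2 ⟨hpos, Finset.card_le_univ _⟩
  have hoff : (a, b) ∈ (rowsOfSum M (rowSum M a)).offDiag := by simp [rowsOfSum, hsum, hab]
  have hw : (rowsOfSum M (rowSum M a)).card.choose 2 ≠ 0 := by
    rw [Finset.mem_offDiag] at hoff
    have : 1 < (rowsOfSum M (rowSum M a)).card :=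
      Finset.one_lt_card.2 ⟨a, hoff.1, b, hoff.2.1, hab⟩
    exact (Nat.choose_pos this).ne'
  have htot : ∑ m ∈ Finset.Icc 1 (Fintype.card κ), (rowsOfSum M m).card.choose 2 ≠ 0 := by
    intro hc
    exact hw (Finset.sum_eq_zero_iff.1 hc _ hmem)
  rw [rowProposal_eq, rowProposalOn, dif_pos htot, ← PMF.mem_support_iff,
    PMF.mem_support_bind_iff]
  exact ⟨_, weightedDraw_ne_zero htot hmem hw, uniformDrawOr_ne_zero hoff h⟩

/-- All binomial weights vanish, so heads proposes `M`. This self-loop excludes period two when no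
row exchange is available. -/
theorem rowProposal_self_ne_zero {M : Matrix ρ κ Bool}
    (h : ∀ a b, rowSum M a = rowSum M b → 0 < rowSum M a → a = b) : rowProposal M M ≠ 0 := by
  rw [rowProposal, dif_neg]
  · simp
  rw [not_not]
  refine Finset.sum_eq_zero fun m hm => Nat.choose_eq_zero_of_lt ?_
  rw [Nat.lt_succ_iff, Finset.card_le_one]
  intro a ha b hb
  simp only [rowsOfSum, Finset.mem_filter, Finset.mem_univ, true_and] at ha hb
  exact h a b (ha.trans hb.symm) (by rw [ha]; exact (Finset.mem_Icc.1 hm).1)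

omit [Fintype ρ] in
theorem rowMove_swapEntries_ne_zero {M : Matrix ρ κ Bool} {a b : ρ} {c d : κ}
    (h1 : M a c = true) (h2 : M b d = true) (h3 : M a d = false) (h4 : M b c = false) :
    rowMove M a b (swapEntries M a b c d) ≠ 0 := by
  have hab : M a ≠ M b := fun h => by rw [h, h4] at h1; simp at h1
  rw [rowMove, if_neg hab]
  exact uniformDrawOr_ne_zero (e := (c, d)) (mem_swapPairs.2 (by simp [h1, h2, h3, h4])) (by simp)

theorem rowProposal_ne_zero_of_isSwap {M M' : Matrix ρ κ Bool}
    (h : IsSwap (fun a b _ _ => rowSum M a = rowSum M b) M M') : rowProposal M M' ≠ 0 := by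
  obtain ⟨a, b, c, d, hsum, h1, h2, h3, h4, rfl⟩ := h
  refine rowProposal_ne_zero (a := a) (b := b) (by rintro rfl; simp_all) hsum ?_
    (rowMove_swapEntries_ne_zero h1 h2 h3 h4)
  exact Finset.card_pos.2 ⟨c, by simp [h1]⟩

theorem isSwap_of_rowProposal_ne_zero {M M' : Matrix ρ κ Bool} (h : rowProposal M M' ≠ 0)
    (hne : M' ≠ M) : IsSwap (fun a b _ _ => rowSum M a = rowSum M b) M M' := by
  rw [rowProposal_eq, rowProposalOn] at h
  split_ifs at h
  · rw [← PMF.mem_support_iff, PMF.mem_support_bind_iff] at h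
    obtain ⟨m, -, hm⟩ := h
    obtain h | ⟨⟨a, b⟩, hab, h⟩ := of_uniformDrawOr_ne_zero hm
    · exact absurd h hne
    simp only [Finset.mem_offDiag, rowsOfSum, Finset.mem_filter, Finset.mem_univ, true_and] at hab
    obtain ⟨-, ⟨c, d⟩, he, rfl⟩ := exists_of_rowMove_ne_zero h hne
    obtain ⟨h1, h2, h3⟩ := mem_swapPairs.1 he
    simp only at h1 h2 h3 ⊢
    have hsum := hab.1.trans hab.2.1.symm
    -- A drawn pair may have the one of row `a` in its second column; the swap is then read with `c`
    -- and `d` interchanged.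
    cases hc : M a c <;> cases hd : M a d <;> rw [hc, hd] at h3
    · simp at h3
    · exact ⟨a, b, d, c, hsum, hd, by simp_all,
        hc, by simp_all, by rw [swapEntries_comm]⟩
    · exact ⟨a, b, c, d, hsum, hc, by simp_all, hd, by simp_all, rfl⟩
    · simp at h3
  · rw [← PMF.mem_support_iff, PMF.mem_support_pure_iff] at h
    exact absurd h hne

theorem isRSO_iff {M M' : Matrix ρ κ Bool} : IsRSO M M' ↔
    IsSwap (fun a b c d => rowSum M a = rowSum M b ∨ colSum M c = colSum M d) M M' := by
  constructor
  · rintro ⟨a, b, c, d, -, -, h1, h2, h3, h4, h, rfl⟩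
    exact ⟨a, b, c, d, h, h1, h2, h3, h4, rfl⟩
  · rintro ⟨a, b, c, d, h, h1, h2, h3, h4, rfl⟩
    exact ⟨a, b, c, d, by rintro rfl; simp_all, by rintro rfl; simp_all, h1, h2, h3, h4, h, rfl⟩

theorem proposal_ne_zero_of_isRSO {M M' : Matrix ρ κ Bool} (h : IsRSO M M') :
    proposal M M' ≠ 0 := by
  obtain ⟨a, b, c, d, h, h'⟩ := isRSO_iff.1 h
  rw [proposal_ne_zero_iff]
  rcases h with h | h
  · exact Or.inl (rowProposal_ne_zero_of_isSwap ⟨a, b, c, d, h, h'⟩)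
  · have hs : IsSwap (fun _ _ c d => colSum M c = colSum M d) M M' := ⟨a, b, c, d, h, h'⟩
    exact Or.inr (rowProposal_ne_zero_of_isSwap hs.transpose)

theorem isRSO_of_proposal_ne_zero {M M' : Matrix ρ κ Bool} (h : proposal M M' ≠ 0)
    (hne : M' ≠ M) : IsRSO M M' := by
  rw [isRSO_iff]
  rw [proposal_ne_zero_iff] at h
  rcases h with h | h
  · exact (isSwap_of_rowProposal_ne_zero h hne).mono fun _ _ _ _ h => Or.inl h
  · have := (isSwap_of_rowProposal_ne_zero h
      (fun h => hne (Matrix.transpose_injective h))).transpose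
    rw [Matrix.transpose_transpose, Matrix.transpose_transpose] at this
    exact this.mono fun _ _ _ _ h => Or.inr h

/-! ### The state space -/

omit [DecidableEq ρ] [DecidableEq κ] in
theorem bjdm_eq (M : Matrix ρ κ Bool) (i j : ℕ) :
    bjdm M i j = ∑ a with rowSum M a = i, rowSpec (colSum M) M a j := by
  simp only [bjdm, rowSpec, Finset.card_filter, Finset.sum_filter, Fintype.sum_prod_type]
  refine Finset.sum_congr rfl fun a _ => ?_
  by_cases h : rowSum M a = i
  · simp only [h, if_true, true_and]
    exact Finset.sum_congr rfl fun c _ => by simp only [and_comm]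
  · simp [h]

/-- Row and column sums are unchanged, so the classes are fixed and the BJDM counts ones in blocks.
A swap within a row class preserves column spectra, one within a column class preserves row spectra;
either determines the block counts. -/
theorem mem_matrices_of_isRSO {Mobs M M' : Matrix ρ κ Bool} (hM : M ∈ matrices Mobs)
    (h : IsRSO M M') : M' ∈ matrices Mobs := by
  rw [isRSO_iff] at h
  have hr := h.rowSum_eq
  have hc := h.colSum_eq
  refine ⟨fun a => (hr a).trans (hM.1 a), fun c => (hc c).trans (hM.2.1 c), ?_⟩
  rw [← hM.2.2]
  ext i j
  rw [bjdm_eq, bjdm_eq, funext hr, funext hc]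
  obtain ⟨a, b, c, d, h | h, h'⟩ := h
  · have hs : IsSwap (fun a b _ _ => rowSum M a = rowSum M b) M M' := ⟨a, b, c, d, h, h'⟩
    rw [sum_rowSpec_eq_sum_colSpec, sum_rowSpec_eq_sum_colSpec _ _ M,
      hs.colSpec_eq fun _ _ _ _ h => h]
  · have hs : IsSwap (fun _ _ c d => colSum M c = colSum M d) M M' := ⟨a, b, c, d, h, h'⟩
    rw [hs.rowSpec_eq fun _ _ _ _ h => h]

/-- The state space is connected by restricted swap operations. -/
theorem reflTransGen_isRSO {Mobs M N : Matrix ρ κ Bool} (hM : M ∈ matrices Mobs)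
    (hN : N ∈ matrices Mobs) : Relation.ReflTransGen IsRSO M N := by
  -- The labels are the sums of `Mobs`, constant along the path, placed in finite types because
  -- balancing sums over labels.
  let f : ρ → Fin (Fintype.card κ + 1) := fun a =>
    ⟨rowSum Mobs a, Nat.lt_succ_of_le (Finset.card_le_univ _)⟩
  let g : κ → Fin (Fintype.card ρ + 1) := fun c =>
    ⟨colSum Mobs c, Nat.lt_succ_of_le (Finset.card_le_univ _)⟩
  have hfi : ∀ a i, f a = i ↔ rowSum Mobs a = i := fun a i => by simp [f, Fin.ext_iff]
  have hgi : ∀ a i, g a = i ↔ colSum Mobs a = i := fun a i => by simp [g, Fin.ext_iff]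
  have hJ : ∀ L ∈ matrices Mobs, ∀ i k,
      ∑ a with f a = i, rowSpec g L a k = bjdm Mobs i k := by
    intro L hL i k
    rw [← hL.2.2, bjdm_eq]
    simp only [rowSpec, hfi, hgi, hL.1, hL.2.1]
  have key := reflTransGen_of_joint_eq f g (M := M) (N := N)
    (fun a b h => by rw [hM.1, hM.1, (hfi a (f b)).1 h])
    (fun a => by rw [hM.1, hN.1])
    (fun a b h => by rw [hM.2.1, hM.2.1, (hgi a (g b)).1 h])
    (fun a => by rw [hM.2.1, hN.2.1])
    (fun i k => by rw [hJ M hM, hJ N hN])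
  suffices Relation.ReflTransGen IsRSO M N ∧ N ∈ matrices Mobs from this.1
  clear hN
  induction key with
  | refl => exact ⟨.refl, hM⟩
  | tail _ hs ih =>
    obtain ⟨hp, hmem⟩ := ih
    have hr := isRSO_iff.2 (hs.mono fun a b c d h => h.imp
      (fun h => by rw [hmem.1, hmem.1, (hfi a (f b)).1 h])
      (fun h => by rw [hmem.2.1, hmem.2.1, (hgi c (g d)).1 h]))
    exact ⟨hp.tail hr, mem_matrices_of_isRSO hmem hr⟩

end Proposal

/-! ### Datasets and their matrices -/

section Counting

/-- Equal multiplicities mean fibres of equal size, and bijections between the fibres are glued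
together. -/
theorem exists_equiv_of_map_eq {α α' β : Type*} [Fintype α] [Fintype α'] {f : α → β} {g : α' → β}
    (h : Finset.univ.val.map f = Finset.univ.val.map g) : ∃ e : α ≃ α', ∀ x, g (e x) = f x := by
  classical
  have hc : ∀ b, Fintype.card {a // f a = b} = Fintype.card {a // g a = b} := by
    intro b
    have := congrArg (Multiset.count b) h
    rw [Multiset.count_map, Multiset.count_map] at this
    rw [Fintype.card_subtype, Fintype.card_subtype]
    simp only [eq_comm (a := b)] at this
    exact this
  exact ⟨Equiv.ofFiberEquiv fun b => Fintype.equivOfCardEq (hc b),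
    fun x => Equiv.ofFiberEquiv_map _ x⟩

theorem map_univ_val_comp_equiv {α α' β : Type*} [Fintype α] [Fintype α'] (e : α ≃ α')
    (g : α' → β) :
    (Finset.univ.val.map fun x => g (e x)) = Finset.univ.val.map g := by
  rw [← Multiset.map_univ_val_equiv e, Multiset.map_map]
  rfl

variable {ρ ρ' κ : Type*} [Fintype ρ] [Fintype ρ'] [Fintype κ] [DecidableEq κ]

/-- The transaction in row `a`. -/
def rowSet (M : Matrix ρ κ Bool) (a : ρ) : Finset κ := Finset.univ.filter fun j => M a j = true

omit [Fintype ρ] [DecidableEq κ] in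
theorem mem_rowSet {M : Matrix ρ κ Bool} {a : ρ} {j : κ} : j ∈ rowSet M a ↔ M a j = true := by
  simp [rowSet]

omit [Fintype ρ] [DecidableEq κ] in
theorem rowSet_injective : Function.Injective (rowSet : Matrix ρ κ Bool → ρ → Finset κ) := by
  intro M N h
  ext a j
  rw [Bool.eq_iff_iff, ← mem_rowSet, ← mem_rowSet, h]

omit [DecidableEq κ] in
theorem toDataset_eq (M : Matrix ρ κ Bool) : toDataset M = Finset.univ.val.map (rowSet M) := rfl

omit [DecidableEq κ] in
theorem toDataset_submatrix (M : Matrix ρ κ Bool) (e : ρ' ≃ ρ) :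
    toDataset (M.submatrix e id) = toDataset M :=
  map_univ_val_comp_equiv e (rowSet M)

omit [Fintype ρ] [Fintype ρ'] [DecidableEq κ] in
theorem rowSum_submatrix (M : Matrix ρ κ Bool) (e : ρ' ≃ ρ) (a : ρ') :
    rowSum (M.submatrix e id) a = rowSum M (e a) := rfl

omit [Fintype κ] [DecidableEq κ] in
theorem colSum_submatrix (M : Matrix ρ κ Bool) (e : ρ' ≃ ρ) (c : κ) :
    colSum (M.submatrix e id) c = colSum M c :=
  Finset.card_equiv e fun a => by
    rw [Finset.mem_filter_univ, Finset.mem_filter_univ]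
    rfl

omit [DecidableEq κ] in
theorem bjdm_submatrix (M : Matrix ρ κ Bool) (e : ρ' ≃ ρ) :
    bjdm (M.submatrix e id) = bjdm M := by
  ext i j
  refine Finset.card_equiv (e.prodCongr (Equiv.refl κ)) fun x => ?_
  simp [rowSum_submatrix, colSum_submatrix]

theorem rowSet_datasetMatrix (D : Multiset (Finset κ)) (x : D) :
    rowSet (datasetMatrix D) x = x.1 := by
  ext j
  simp [mem_rowSet, datasetMatrix]

theorem toDataset_datasetMatrix (D : Multiset (Finset κ)) : toDataset (datasetMatrix D) = D := by
  rw [toDataset_eq, funext (rowSet_datasetMatrix D)]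
  exact Multiset.map_univ_coe D

omit [DecidableEq κ] in
theorem exists_submatrix_eq {M : Matrix ρ κ Bool} {N : Matrix ρ' κ Bool}
    (h : toDataset M = toDataset N) : ∃ e : ρ ≃ ρ', N.submatrix e id = M := by
  obtain ⟨e, he⟩ := exists_equiv_of_map_eq h
  exact ⟨e, rowSet_injective (funext he)⟩

omit [DecidableEq κ] in
theorem bjdm_eq_of_toDataset_eq {M : Matrix ρ κ Bool} {N : Matrix ρ' κ Bool}
    (h : toDataset M = toDataset N) : bjdm M = bjdm N := by
  obtain ⟨e, rfl⟩ := exists_submatrix_eq h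
  exact bjdm_submatrix N e

theorem bjdm_datasetMatrix (M : Matrix ρ κ Bool) :
    bjdm (datasetMatrix (toDataset M)) = bjdm M :=
  bjdm_eq_of_toDataset_eq (toDataset_datasetMatrix _)

theorem itemSupport_toDataset (M : Matrix ρ κ Bool) (i : κ) :
    itemSupport (toDataset M) i = colSum M i := by
  rw [itemSupport, toDataset_eq, Multiset.filter_map, Multiset.card_map]
  simp only [Function.comp_def, mem_rowSet]
  rfl

omit [Fintype κ] [DecidableEq κ] in
theorem count_map_card (D : Multiset (Finset κ)) (l : ℕ) :
    (D.map Finset.card).count l = numLength D l := by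
  rw [Multiset.count_map, numLength]
  simp only [eq_comm]

omit [DecidableEq κ] in
theorem map_card_toDataset (M : Matrix ρ κ Bool) :
    (toDataset M).map Finset.card = Finset.univ.val.map (rowSum M) := by
  rw [toDataset_eq, Multiset.map_map]
  rfl

theorem toDataset_mem_nullSet {Mobs M : Matrix ρ κ Bool} (hM : M ∈ matrices Mobs) :
    toDataset M ∈ nullSet (toDataset Mobs) := by
  refine ⟨fun l => ?_, fun i => ?_, ?_⟩
  · rw [← count_map_card, ← count_map_card, map_card_toDataset, map_card_toDataset, funext hM.1]
  · rw [itemSupport_toDataset, itemSupport_toDataset, hM.2.1]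
  · rw [bjdm_datasetMatrix, bjdm_datasetMatrix, hM.2.2]

theorem mem_matrices_of_nullSet {Mobs M : Matrix ρ κ Bool}
    (hM : toDataset M ∈ nullSet (toDataset Mobs)) (hr : ∀ a, rowSum M a = rowSum Mobs a) :
    M ∈ matrices Mobs := by
  refine ⟨hr, fun i => ?_, ?_⟩
  · rw [← itemSupport_toDataset, hM.2.1, itemSupport_toDataset]
  · rw [← bjdm_datasetMatrix M, hM.2.2, bjdm_datasetMatrix]

/-- Equal length counts allow the transactions of `D` to be indexed by `ρ` with the row sums of
`Mobs` in their given order. -/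
theorem exists_matrix {Mobs : Matrix ρ κ Bool} {D : Multiset (Finset κ)}
    (hD : D ∈ nullSet (toDataset Mobs)) : ∃ M ∈ matrices Mobs, toDataset M = D := by
  have h : Finset.univ.val.map (rowSum Mobs) =
      Finset.univ.val.map (rowSum (datasetMatrix D)) := by
    rw [← map_card_toDataset, ← map_card_toDataset, toDataset_datasetMatrix]
    ext l
    rw [count_map_card, count_map_card, hD.1]
  obtain ⟨e, he⟩ := exists_equiv_of_map_eq h
  have hd : toDataset ((datasetMatrix D).submatrix e id) = D := by
    rw [toDataset_submatrix, toDataset_datasetMatrix]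
  exact ⟨_, mem_matrices_of_nullSet
    (show toDataset ((datasetMatrix D).submatrix e id) ∈ _ by rwa [hd]) he, hd⟩

omit [Fintype κ] in
-- The defining quotient of `copies` with denominators cleared, ready for orbit counting.
theorem copies_mul_prod (D : Multiset (Finset κ)) :
    copies D * ∏ τ ∈ D.toFinset, (D.count τ).factorial =
      ∏ l ∈ (D.map Finset.card).toFinset, (numLength D l).factorial := by
  rw [← Finset.prod_fiberwise_of_maps_to (s := D.toFinset) (t := (D.map Finset.card).toFinset)
    (g := Finset.card) (fun τ hτ => by
      rw [Multiset.mem_toFinset] at hτ ⊢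
      exact Multiset.mem_map_of_mem _ hτ), copies, ← Finset.prod_mul_distrib]
  refine Finset.prod_congr rfl fun l _ => ?_
  have h1 : D.toFinset.filter (fun τ => τ.card = l) =
      (D.filter fun t => t.card = l).toFinset := by
    ext τ
    simp
  have h2 : ∏ τ ∈ (D.filter fun t => t.card = l).toFinset, (D.count τ).factorial =
      ∏ τ ∈ (D.filter fun t => t.card = l).toFinset,
        ((D.filter fun t => t.card = l).count τ).factorial := by
    refine Finset.prod_congr rfl fun τ hτ => ?_
    rw [Multiset.mem_toFinset, Multiset.mem_filter] at hτ
    rw [Multiset.count_filter_of_pos (p := fun t : Finset κ => t.card = l) hτ.2]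
  rw [h1, h2, mul_comm, Nat.multinomial_spec, Multiset.toFinset_sum_count_eq, numLength]

omit [Fintype κ] in
theorem copies_pos (D : Multiset (Finset κ)) : 0 < copies D :=
  Finset.prod_pos fun _ _ => Nat.multinomial_pos _ _

/-- A permutation stabilises `f` exactly when it permutes each fibre, independently of the others.
-/
theorem card_perm_comp_eq {α β : Type*} [Fintype α] [DecidableEq α] [DecidableEq β] (f : α → β) :
    (Finset.univ.filter fun σ : Equiv.Perm α => f ∘ σ = f).card =
      ∏ b ∈ (Finset.univ.val.map f).toFinset,
        ((Finset.univ.val.map f).count b).factorial := by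
  rw [← Fintype.card_subtype, DomMulAct.stabilizer_card']
  refine Finset.prod_congr rfl fun b _ => ?_
  rw [Multiset.count_map, Fintype.card_subtype]
  simp only [eq_comm]
  rfl

/-- The number of matrices in the state space with a given dataset in the null set. -/
theorem ncard_toDataset_eq [DecidableEq ρ] {Mobs : Matrix ρ κ Bool} {D : Multiset (Finset κ)}
    (hD : D ∈ nullSet (toDataset Mobs)) :
    {M | M ∈ matrices Mobs ∧ toDataset M = D}.ncard = copies D := by
  classical
  obtain ⟨M₀, hM₀, hMD⟩ := exists_matrix hD
  have hset : {M | M ∈ matrices Mobs ∧ toDataset M = D} =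
      ((Finset.univ.filter fun M => M ∈ matrices Mobs ∧ toDataset M = D :
        Finset (Matrix ρ κ Bool)) : Set (Matrix ρ κ Bool)) := by
    ext
    simp
  rw [hset, Set.ncard_coe_finset]
  set F : Finset (Matrix ρ κ Bool) :=
    Finset.univ.filter fun M => M ∈ matrices Mobs ∧ toDataset M = D with hF
  have hmaps : Set.MapsTo (fun σ : Equiv.Perm ρ => M₀.submatrix σ id)
      ((Finset.univ.filter fun σ : Equiv.Perm ρ => rowSum Mobs ∘ σ = rowSum Mobs :
        Finset (Equiv.Perm ρ)) : Set (Equiv.Perm ρ)) F := by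
    intro σ hσ
    simp only [Finset.coe_filter, Finset.mem_univ, true_and, Set.mem_ofPred_eq] at hσ
    have hd : toDataset (M₀.submatrix σ id) = D := by rw [toDataset_submatrix, hMD]
    simp only [hF, Finset.coe_filter, Finset.mem_univ, true_and, Set.mem_ofPred_eq]
    refine ⟨mem_matrices_of_nullSet (by rwa [hd]) fun a => ?_, hd⟩
    rw [rowSum_submatrix, hM₀.1]
    exact congrFun hσ a
  have hcard := Finset.card_eq_sum_card_fiberwise hmaps
  -- The permutations that carry `M₀` to `M` form a coset of the stabiliser of the rows of `M₀`.
  -- They preserve row sums automatically, since `M` and `M₀` have the same ones.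
  have hfib : ∀ M ∈ F, ((Finset.univ.filter fun σ : Equiv.Perm ρ =>
      rowSum Mobs ∘ σ = rowSum Mobs).filter fun σ : Equiv.Perm ρ => M₀.submatrix σ id = M).card =
      (Finset.univ.filter fun σ : Equiv.Perm ρ => rowSet M₀ ∘ σ = rowSet M₀).card := by
    intro M hM
    simp only [hF, Finset.mem_filter, Finset.mem_univ, true_and] at hM
    obtain ⟨τ, hτ⟩ := exists_submatrix_eq (hM.2.trans hMD.symm)
    have hτ' : rowSet M = rowSet M₀ ∘ τ := by rw [← hτ]; rfl
    refine Finset.card_equiv (Equiv.mulRight τ⁻¹) fun σ => ?_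
    simp only [Finset.mem_filter, Finset.mem_univ, true_and, Equiv.coe_mulRight]
    have h1 : M₀.submatrix σ id = M ↔ rowSet M₀ ∘ σ = rowSet M :=
      ⟨fun h => by rw [← h]; rfl, fun h => rowSet_injective h⟩
    rw [h1, hτ']
    constructor
    · rintro ⟨-, h⟩
      rw [Equiv.Perm.coe_mul, ← Function.comp_assoc, h]
      ext1 a
      simp
    · intro h
      have h2 : rowSet M₀ ∘ σ = rowSet M₀ ∘ τ := by
        conv_rhs => rw [← h]
        ext1 a
        simp
      refine ⟨?_, h2⟩
      ext a
      have h3 := congrArg Finset.card (congrFun (h2.trans hτ'.symm) a)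
      change rowSum M₀ (σ a) = rowSum M a at h3
      rwa [hM₀.1, hM.1.1] at h3
  rw [Finset.sum_congr rfl hfib, Finset.sum_const, smul_eq_mul, card_perm_comp_eq,
    card_perm_comp_eq, ← toDataset_eq, hMD] at hcard
  have hlen : ∏ b ∈ (Finset.univ.val.map (rowSum Mobs)).toFinset,
      ((Finset.univ.val.map (rowSum Mobs)).count b).factorial =
      ∏ l ∈ (D.map Finset.card).toFinset, (numLength D l).factorial := by
    rw [← funext hM₀.1, ← map_card_toDataset, hMD]
    simp only [count_map_card]
  rw [hlen, ← copies_mul_prod] at hcard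
  exact (Nat.eq_of_mul_eq_mul_right (Finset.prod_pos fun _ _ => Nat.factorial_pos _) hcard).symm

end Counting

/-! ### Reversible Markov chains on finite sets -/

section Reversible

open Filter

variable {S : Type*} [Fintype S]

/-- The action of a transition matrix on functions. -/
def markovOp (K : S → S → ℝ) (f : S → ℝ) (x : S) : ℝ := ∑ y, K x y * f y

/-- The bilinear form on functions with weights `π`. -/
def wInner (π f g : S → ℝ) : ℝ := ∑ x, π x * f x * g x

/-- A transition matrix `K` with a reversible probability distribution `π`. -/
structure IsReversible (π : S → ℝ) (K : S → S → ℝ) : Prop where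
  nonneg : ∀ x, 0 ≤ π x
  sum_eq_one : ∑ x, π x = 1
  kernel_nonneg : ∀ x y, 0 ≤ K x y
  kernel_sum : ∀ x, ∑ y, K x y = 1
  balance : ∀ x y, π x * K x y = π y * K y x

variable {π : S → ℝ} {K : S → S → ℝ}

theorem wInner_congr {π f g f' g' : S → ℝ} (hf : ∀ x, π x ≠ 0 → f x = f' x)
    (hg : ∀ x, π x ≠ 0 → g x = g' x) : wInner π f g = wInner π f' g' := by
  refine Finset.sum_congr rfl fun x _ => ?_
  by_cases h : π x = 0
  · simp [h]
  · rw [hf x h, hg x h]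

namespace IsReversible

variable (H : IsReversible π K)

include H

theorem wInner_markovOp (f g : S → ℝ) :
    wInner π (markovOp K f) g = wInner π f (markovOp K g) := by
  simp only [wInner, markovOp, Finset.mul_sum, Finset.sum_mul]
  rw [Finset.sum_comm]
  refine Finset.sum_congr rfl fun x _ => Finset.sum_congr rfl fun y _ => ?_
  linear_combination (f x * g y) * H.balance y x

theorem markovOp_one : markovOp K (fun _ => 1) = fun _ => 1 := by
  ext x
  simp [markovOp, H.kernel_sum]

theorem wInner_nonneg (f : S → ℝ) : 0 ≤ wInner π f f :=
  Finset.sum_nonneg fun x _ => by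
    rw [mul_assoc]
    exact mul_nonneg (H.nonneg x) (mul_self_nonneg _)

theorem pos_of_ne {x : S} (h : π x ≠ 0) : 0 < π x := lt_of_le_of_ne (H.nonneg x) h.symm

/-- Transitions never leave the support of `π`, so eigenvalue equations and limits are needed only
there. -/
theorem pos_of_kernel_pos {x y : S} (hx : 0 < π x) (hK : 0 < K x y) : 0 < π y := by
  refine H.pos_of_ne fun h => ?_
  have := H.balance x y
  rw [h, zero_mul] at this
  exact (mul_pos hx hK).ne' this

theorem mul_sq_le_wInner (f : S → ℝ) (x : S) : π x * f x ^ 2 ≤ wInner π f f := by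
  rw [sq, ← mul_assoc]
  refine Finset.single_le_sum (f := fun x => π x * f x * f x) (fun y _ => ?_) (Finset.mem_univ x)
  rw [mul_assoc]
  exact mul_nonneg (H.nonneg y) (mul_self_nonneg _)

theorem sum_sum_sq (f : S → ℝ) : ∑ x, ∑ y, π x * K x y * f y ^ 2 = wInner π f f := by
  rw [Finset.sum_comm]
  refine Finset.sum_congr rfl fun y _ => ?_
  simp only [H.balance _ y]
  rw [← Finset.sum_mul, ← Finset.mul_sum, H.kernel_sum]
  ring

/-- The variance of `f` after one step from `x` is nonnegative; averaging over the stationary `π`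
gives the contraction. -/
theorem wInner_markovOp_self_le (f : S → ℝ) :
    wInner π (markovOp K f) (markovOp K f) ≤ wInner π f f := by
  rw [← H.sum_sum_sq f]
  refine Finset.sum_le_sum fun x _ => ?_
  have h1 : 0 ≤ ∑ y, K x y * (f y - markovOp K f x) ^ 2 :=
    Finset.sum_nonneg fun y _ => mul_nonneg (H.kernel_nonneg x y) (sq_nonneg _)
  have h2 : ∑ y, K x y * (f y - markovOp K f x) ^ 2 =
      ∑ y, K x y * f y ^ 2 - markovOp K f x ^ 2 := by
    have : ∀ y, K x y * (f y - markovOp K f x) ^ 2 = K x y * f y ^ 2 -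
        2 * markovOp K f x * (K x y * f y) + markovOp K f x ^ 2 * K x y := fun y => by ring
    simp only [this, Finset.sum_add_distrib, Finset.sum_sub_distrib, ← Finset.mul_sum,
      H.kernel_sum]
    rw [show ∑ y, K x y * f y = markovOp K f x from rfl]
    ring
  rw [h2] at h1
  simp only [mul_assoc]
  rw [← Finset.mul_sum]
  exact mul_le_mul_of_nonneg_left (by linarith) (H.nonneg x)

/-- Eigenfunctions for the eigenvalues `1` and `-1` satisfy the eigenvalue equation along each
transition. -/
theorem eq_mul_of_eigen {f : S → ℝ} {c : ℝ} (hc : c ^ 2 = 1)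
    (hf : ∀ x, 0 < π x → markovOp K f x = c * f x) {x y : S} (hx : 0 < π x) (hK : 0 < K x y) :
    f y = c * f x := by
  -- Expanding gives `(1 - 2 * c ^ 2 + c ^ 2) * wInner π f f`, which vanishes because `c ^ 2 = 1`.
  have h1 : ∑ x, ∑ y, π x * K x y * (f y - c * f x) ^ 2 = 0 := by
    have e : ∀ x, ∑ y, π x * K x y * (f y - c * f x) ^ 2 =
        ∑ y, π x * K x y * f y ^ 2 - π x * f x * f x := by
      intro x
      have e' : ∀ y, π x * K x y * (f y - c * f x) ^ 2 = π x * K x y * f y ^ 2 -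
          2 * π x * c * f x * (K x y * f y) + π x * c ^ 2 * f x ^ 2 * K x y := fun y => by ring
      simp only [e', Finset.sum_add_distrib, Finset.sum_sub_distrib, ← Finset.mul_sum,
        H.kernel_sum]
      rw [show ∑ y, K x y * f y = markovOp K f x from rfl]
      rcases (H.nonneg x).eq_or_lt with h | h
      · simp [← h]
      · rw [hf x h]
        linear_combination (-π x * f x ^ 2) * hc
    simp only [e, Finset.sum_sub_distrib, H.sum_sum_sq]
    exact sub_self _
  have hnn : ∀ x y, 0 ≤ π x * K x y * (f y - c * f x) ^ 2 := fun x y =>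
    mul_nonneg (mul_nonneg (H.nonneg x) (H.kernel_nonneg x y)) (sq_nonneg _)
  have h2 := (Finset.sum_eq_zero_iff_of_nonneg fun x _ => Finset.sum_nonneg fun y _ => hnn x y).1
    h1 x (Finset.mem_univ x)
  have h3 := (Finset.sum_eq_zero_iff_of_nonneg fun y _ => hnn x y).1 h2 y (Finset.mem_univ y)
  have h4 := (mul_eq_zero.1 h3).resolve_left (mul_pos hx hK).ne'
  exact sub_eq_zero.1 (pow_eq_zero_iff two_ne_zero |>.1 h4)

theorem eq_of_harmonic
    (hconn : ∀ x y, 0 < π x → 0 < π y → Relation.ReflTransGen (fun x y => 0 < K x y) x y)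
    {f : S → ℝ} (hf : ∀ x, 0 < π x → markovOp K f x = f x) {x y : S} (hx : 0 < π x)
    (hy : 0 < π y) : f y = f x := by
  suffices f y = f x ∧ 0 < π y from this.1
  have hp := hconn x y hx hy
  clear hy
  induction hp with
  | refl => exact ⟨rfl, hx⟩
  | tail _ hK ih =>
    refine ⟨?_, H.pos_of_kernel_pos ih.2 hK⟩
    rw [H.eq_mul_of_eigen (f := f) (c := 1) (by norm_num) (by simpa using hf) ih.2 hK, one_mul, ih.1]

/-- An irreducible reversible chain has only one stationary distribution. -/
theorem eq_of_stationary
    (hconn : ∀ x y, 0 < π x → 0 < π y → Relation.ReflTransGen (fun x y => 0 < K x y) x y)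
    {μ : S → ℝ} (hμ : ∀ x, π x = 0 → μ x = 0) (hsum : ∑ x, μ x = 1)
    (hst : ∀ y, ∑ x, μ x * K x y = μ y) : μ = π := by
  -- By detailed balance, stationarity of `μ` says that its density with respect to `π` is harmonic,
  -- hence constant on the support.
  have hharm : ∀ x, 0 < π x → markovOp K (fun x => μ x / π x) x = μ x / π x := by
    intro x hx
    rw [markovOp, ← hst x, Finset.sum_div]
    refine Finset.sum_congr rfl fun y _ => ?_
    by_cases hy : π y = 0
    · simp [hμ y hy]
    · field_simp
      linear_combination μ y * H.balance x y
  obtain ⟨x, hx⟩ : ∃ x, 0 < π x := by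
    by_contra! hc
    have : ∑ x, π x ≤ 0 := Finset.sum_nonpos fun x _ => hc x
    rw [H.sum_eq_one] at this
    norm_num at this
  have hμπ : ∀ y, μ y = μ x / π x * π y := by
    intro y
    rcases (H.nonneg y).eq_or_lt with hy | hy
    · rw [← hy, hμ y hy.symm, mul_zero]
    · rw [← H.eq_of_harmonic hconn hharm hx hy]
      field_simp
  have hc : μ x / π x = 1 := by
    have : ∑ y, μ x / π x * π y = 1 := by
      rw [← hsum]
      exact Finset.sum_congr rfl fun y _ => (hμπ y).symm
    rwa [← Finset.mul_sum, H.sum_eq_one, mul_one] at this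
  ext y
  rw [hμπ y, hc, one_mul]

theorem tendsto_markovOp {u : ℕ → S → ℝ} {U : S → ℝ}
    (hu : ∀ x, 0 < π x → Tendsto (fun n => u n x) atTop (𝓝 (U x))) {x : S} (hx : 0 < π x) :
    Tendsto (fun n => markovOp K (u n) x) atTop (𝓝 (markovOp K U x)) := by
  refine tendsto_finsetSum _ fun y _ => ?_
  by_cases hy : 0 < K x y
  · exact (hu y (H.pos_of_kernel_pos hx hy)).const_mul _
  · have : K x y = 0 := le_antisymm (not_lt.1 hy) (H.kernel_nonneg x y)
    simp [this]

theorem tendsto_wInner {u : ℕ → S → ℝ} {U : S → ℝ}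
    (hu : ∀ x, 0 < π x → Tendsto (fun n => u n x) atTop (𝓝 (U x))) (g : S → ℝ) :
    Tendsto (fun n => wInner π (u n) g) atTop (𝓝 (wInner π U g)) := by
  refine tendsto_finsetSum _ fun x _ => ?_
  rcases (H.nonneg x).eq_or_lt with h | h
  · simp [← h]
  · exact ((hu x h).const_mul _).mul_const _

theorem wInner_iterate {f : ℕ → S → ℝ} (hf : ∀ s, f (s + 1) = markovOp K (f s)) (s t : ℕ) :
    wInner π (f s) (f t) = wInner π (f 0) (f (s + t)) := by
  induction s generalizing t with
  | zero => rw [zero_add]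
  | succ s ih =>
    rw [hf, H.wInner_markovOp, ← hf, ih]
    congr 2
    omega

/-- The iterates of even order converge. -/
theorem exists_tendsto_even {f : ℕ → S → ℝ} (hf : ∀ s, f (s + 1) = markovOp K (f s)) :
    ∃ F : S → ℝ, ∀ x, 0 < π x → Tendsto (fun s => f (2 * s) x) atTop (𝓝 (F x)) := by
  suffices ∀ x, ∃ l, 0 < π x → Tendsto (fun s => f (2 * s) x) atTop (𝓝 l) by
    choose F hF using this
    exact ⟨F, hF⟩
  intro x
  by_cases hx : 0 < π x
  swap
  · exact ⟨0, fun h => absurd h hx⟩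
  let b : ℕ → ℝ := fun s => wInner π (f s) (f s)
  have hanti : Antitone b := antitone_nat_of_succ_le fun s => by
    simp only [b, hf]
    exact H.wInner_markovOp_self_le _
  have hb := tendsto_atTop_ciInf hanti ⟨0, by rintro _ ⟨s, rfl⟩; exact H.wInner_nonneg _⟩
  set L := ⨅ s, b s
  -- Self-adjointness turns the inner product of the iterates `2 * s` and `2 * t` into the squared
  -- norm `b (s + t)`. As `b` decreases to a limit, the even iterates are Cauchy.
  have hdist : ∀ s t, π x * (f (2 * s) x - f (2 * t) x) ^ 2 ≤
      b (2 * s) + b (2 * t) - 2 * b (s + t) := by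
    intro s t
    have h1 := H.mul_sq_le_wInner (fun x => f (2 * s) x - f (2 * t) x) x
    have h2 : wInner π (fun x => f (2 * s) x - f (2 * t) x) (fun x => f (2 * s) x - f (2 * t) x) =
        b (2 * s) + b (2 * t) - 2 * wInner π (f (2 * s)) (f (2 * t)) := by
      simp only [wInner, b, Finset.mul_sum, ← Finset.sum_add_distrib, ← Finset.sum_sub_distrib]
      exact Finset.sum_congr rfl fun y _ => by ring
    have h3 : wInner π (f (2 * s)) (f (2 * t)) = b (s + t) := by
      simp only [b]
      rw [H.wInner_iterate hf, H.wInner_iterate hf (s + t)]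
      congr 2
      omega
    rw [h2, h3] at h1
    exact h1
  have hcauchy : CauchySeq fun s => f (2 * s) x := by
    rw [Metric.cauchySeq_iff]
    intro ε hε
    have hε' : 0 < π x * ε ^ 2 / 4 := by positivity
    obtain ⟨N, hN⟩ := Metric.tendsto_atTop.1 hb _ hε'
    refine ⟨N, fun s hs t ht => ?_⟩
    have h1 := abs_lt.1 (hN (2 * s) (by omega))
    have h2 := abs_lt.1 (hN (2 * t) (by omega))
    have h3 := abs_lt.1 (hN (s + t) (by omega))
    have h4 := hdist s t
    have h5 : π x * (f (2 * s) x - f (2 * t) x) ^ 2 < π x * ε ^ 2 := by linarith [h1.2, h2.2, h3.1]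
    rw [Real.dist_eq]
    exact abs_lt_of_sq_lt_sq (lt_of_mul_lt_mul_left h5 hx.le) hε.le
  obtain ⟨l, hl⟩ := cauchySeq_tendsto_of_complete hcauchy
  exact ⟨l, fun _ => hl⟩

/-- Convergence to equilibrium of an irreducible, possibly periodic, reversible chain for an
observable that is invariant under a symmetry `τ` which changes the sign of every
`(-1)`-eigenfunction. -/
theorem tendsto_iterate
    (hconn : ∀ x y, 0 < π x → 0 < π y → Relation.ReflTransGen (fun x y => 0 < K x y) x y)
    {f : ℕ → S → ℝ} (hf : ∀ s, f (s + 1) = markovOp K (f s)) (τ : Equiv.Perm S)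
    (hτπ : ∀ x, π (τ x) = π x) (hτf : ∀ x, f 0 (τ x) = f 0 x)
    (hτ : ∀ h : S → ℝ, (∀ x y, 0 < π x → 0 < K x y → h y = -h x) → ∀ x, 0 < π x → h (τ x) = -h x)
    {x : S} (hx : 0 < π x) :
    Tendsto (fun s => f s x) atTop (𝓝 (∑ y, π y * f 0 y)) := by
  obtain ⟨F, hF⟩ := H.exists_tendsto_even hf
  have hodd : ∀ x, 0 < π x → Tendsto (fun s => f (2 * s + 1) x) atTop (𝓝 (markovOp K F x)) := by
    intro x hx
    simp only [hf]
    exact H.tendsto_markovOp hF hx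
  have hTT : ∀ x, 0 < π x → markovOp K (markovOp K F) x = F x := by
    intro x hx
    have h1 := H.tendsto_markovOp hodd hx
    simp only [← hf] at h1
    exact tendsto_nhds_unique h1 ((hF x hx).comp (tendsto_add_atTop_nat 1))
  -- Half the difference of the even and odd limits would be the projection to eigenvalue -1; it
  -- remains to show that `h` vanishes on the support.
  set h : S → ℝ := fun x => F x - markovOp K F x with hh
  have hTh : ∀ x, 0 < π x → markovOp K h x = -1 * h x := by
    intro x hx
    have : markovOp K h x = markovOp K F x - markovOp K (markovOp K F) x := by
      simp only [markovOp, hh, mul_sub, Finset.sum_sub_distrib]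
    rw [this, hTT x hx]
    simp [hh]
  have hhτ := hτ h fun x y hx hK => by
    rw [H.eq_mul_of_eigen (by norm_num) hTh hx hK, neg_one_mul]
  -- Substituting `τ` preserves `π` and `f 0` and changes the sign of `h`, so the pairing equals its
  -- own negative.
  have hf0 : wInner π (f 0) h = 0 := by
    have h1 : wInner π (f 0) h = -wInner π (f 0) h := by
      conv_lhs => rw [wInner, ← Equiv.sum_comp τ]
      rw [wInner, ← Finset.sum_neg_distrib]
      refine Finset.sum_congr rfl fun x _ => ?_
      rw [hτπ, hτf]
      rcases (H.nonneg x).eq_or_lt with h0 | h0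
      · simp [← h0]
      · rw [hhτ x h0]
        ring
    linarith
  have hneg : ∀ g : S → ℝ, wInner π (markovOp K g) h = -wInner π g h := by
    intro g
    rw [H.wInner_markovOp, wInner_congr (fun _ _ => rfl) fun x hx => hTh x (H.pos_of_ne hx)]
    simp only [wInner, ← Finset.sum_neg_distrib]
    exact Finset.sum_congr rfl fun y _ => by ring
  have hfs : ∀ s, wInner π (f s) h = 0 := by
    intro s
    induction s with
    | zero => exact hf0
    | succ s ih => rw [hf, hneg, ih, neg_zero]
  have hFh : wInner π F h = 0 := by
    have h1 := H.tendsto_wInner hF h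
    simp only [hfs] at h1
    exact tendsto_nhds_unique h1 tendsto_const_nhds
  -- Pairing with `h` changes sign under `markovOp K`, so `wInner π h h` is twice `wInner π F h`,
  -- which is zero as a limit of zeros.
  have hhh : wInner π h h = 0 := by
    have h1 : wInner π h h = wInner π F h - wInner π (markovOp K F) h := by
      simp only [wInner, ← Finset.sum_sub_distrib]
      exact Finset.sum_congr rfl fun y _ => by simp only [hh]; ring
    rw [h1, hneg, hFh, neg_zero, sub_zero]
  have hharm : ∀ x, 0 < π x → markovOp K F x = F x := by
    intro x hx
    have h1 := H.mul_sq_le_wInner h x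
    rw [hhh] at h1
    have h2 : h x ^ 2 = 0 :=
      le_antisymm (nonpos_of_mul_nonpos_right h1 hx) (sq_nonneg _)
    have h3 : h x = 0 := pow_eq_zero_iff two_ne_zero |>.1 h2
    simp only [hh] at h3
    linarith
  have hone : ∀ s, wInner π (f s) (fun _ => 1) = ∑ y, π y * f 0 y := by
    intro s
    induction s with
    | zero => simp [wInner]
    | succ s ih => rw [hf, H.wInner_markovOp, H.markovOp_one, ih]
  have hFx : F x = ∑ y, π y * f 0 y := by
    have h1 := H.tendsto_wInner hF fun _ => 1
    simp only [hone] at h1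
    rw [← tendsto_nhds_unique h1 tendsto_const_nhds,
      wInner_congr (f' := fun _ => F x) (g' := fun _ => 1)
        (fun y hy => H.eq_of_harmonic hconn hharm hx (H.pos_of_ne hy)) (fun _ _ => rfl)]
    simp [wInner, ← Finset.sum_mul, H.sum_eq_one]
  rw [← hFx]
  have h1 := hF x hx
  have h2 := hodd x hx
  rw [hharm x hx] at h2
  rw [Metric.tendsto_atTop] at h1 h2 ⊢
  intro ε hε
  obtain ⟨N₁, h1⟩ := h1 ε hε
  obtain ⟨N₂, h2⟩ := h2 ε hε
  refine ⟨2 * (N₁ + N₂) + 1, fun n hn => ?_⟩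
  obtain ⟨k, rfl | rfl⟩ := n.even_or_odd'
  · exact h1 k (by omega)
  · exact h2 k (by omega)

end IsReversible

end Reversible

/-! ### The Metropolis–Hastings step -/

section MetropolisHastings

variable {S β : Type*}

theorem bind_congr_of_ne_zero {p : PMF S} {f g : S → PMF β} (h : ∀ a, p a ≠ 0 → f a = g a) :
    p.bind f = p.bind g := by
  ext b
  simp only [PMF.bind_apply]
  refine tsum_congr fun a => ?_
  by_cases ha : p a = 0
  · rw [ha, zero_mul, zero_mul]
  · rw [h a ha]

theorem coin_bind_apply (p : ℝ≥0∞) (hp : p ≤ 1) (F : Bool → PMF β) (x : β) :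
    (coin p hp).bind F x = p * F true x + (1 - p) * F false x := by
  rw [PMF.bind_apply, tsum_bool, add_comm]
  simp [coin]

variable {π : S → ℝ≥0∞} {q : S → PMF S}

theorem mhStep_apply (u v : S) : mhStep π q v u = ∑' w, q v w *
    (mhAccept π q v w * PMF.pure w u + (1 - mhAccept π q v w) * PMF.pure v u) :=
  tsum_congr fun w => congrArg (q v w * ·)
    (coin_bind_apply (mhAccept π q v w) (min_le_left _ _)
      (fun x => PMF.pure (if x then w else v)) u)

theorem mhStep_apply_of_ne {u v : S} (h : u ≠ v) :
    mhStep π q v u = q v u * mhAccept π q v u := by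
  rw [mhStep_apply, tsum_eq_single u]
  · simp [h]
  · intro w hw
    simp [h, hw.symm]

theorem mhStep_ne_zero {u v : S} (h : q v u ≠ 0) (ha : mhAccept π q v u ≠ 0) :
    mhStep π q v u ≠ 0 := by
  rw [mhStep_apply]
  intro hc
  have := ENNReal.tsum_eq_zero.1 hc u
  simp [h, ha] at this

theorem mhAccept_ne_zero {u v : S} (hu : π u ≠ 0) (hq : q u v ≠ 0) (hv : π v ≠ ⊤) :
    mhAccept π q v u ≠ 0 := by
  have h1 : π u * q u v ≠ 0 := mul_ne_zero hu hq
  have h2 : π v * q v u ≠ ⊤ := ENNReal.mul_ne_top hv ((q v).apply_ne_top u)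
  have h3 : 0 < π u * q u v / (π v * q v u) := ENNReal.div_pos h1 h2
  exact (lt_min one_pos h3).ne'

theorem mul_min_one_div {a : ℝ≥0∞} (ha : a ≠ ⊤) (b : ℝ≥0∞) : a * min 1 (b / a) = min a b := by
  by_cases h : a = 0
  · simp [h]
  · rw [mul_min, mul_one, ENNReal.mul_div_cancel h ha]

/-- Off the diagonal, both sides are the minimum of the two proposed flows `π v * q v u` and `π u *
q u v`. -/
theorem mhStep_balance (hπ : ∀ v, π v ≠ ⊤) (u v : S) :
    π v * mhStep π q v u = π u * mhStep π q u v := by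
  by_cases h : u = v
  · rw [h]
  have ht : ∀ v u, π v * q v u ≠ ⊤ := fun v u => ENNReal.mul_ne_top (hπ v) ((q v).apply_ne_top u)
  rw [mhStep_apply_of_ne h, mhStep_apply_of_ne (Ne.symm h), ← mul_assoc, ← mul_assoc, mhAccept,
    mhAccept, mul_min_one_div (ht v u), mul_min_one_div (ht u v), min_comm]

end MetropolisHastings

/-! ### The chain on matrices -/

section Chain

variable {ρ κ : Type*} [Fintype ρ] [Fintype κ] [DecidableEq ρ] [DecidableEq κ]

open Classical in
/-- The matrices in the state space with dataset `D`. -/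
noncomputable def matricesOf (Mobs : Matrix ρ κ Bool) (D : Multiset (Finset κ)) :
    Finset (Matrix ρ κ Bool) :=
  Finset.univ.filter fun M => M ∈ matrices Mobs ∧ toDataset M = D

theorem mem_matricesOf {Mobs M : Matrix ρ κ Bool} {D : Multiset (Finset κ)} :
    M ∈ matricesOf Mobs D ↔ M ∈ matrices Mobs ∧ toDataset M = D := by
  simp [matricesOf]

theorem card_matricesOf {Mobs : Matrix ρ κ Bool} {D : Multiset (Finset κ)}
    (hD : D ∈ nullSet (toDataset Mobs)) : (matricesOf Mobs D).card = copies D := by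
  rw [← ncard_toDataset_eq hD, ← Set.ncard_coe_finset]
  congr
  ext
  simp [mem_matricesOf]

/-- The law of a uniformly random matrix of a dataset drawn from `P`. -/
noncomputable def matrixLaw (Mobs : Matrix ρ κ Bool) (P : PMF (Multiset (Finset κ))) :
    PMF (Matrix ρ κ Bool) :=
  P.bind fun D => uniformDrawOr (matricesOf Mobs D) Mobs PMF.pure

theorem matricesOf_nonempty {Mobs : Matrix ρ κ Bool} {D : Multiset (Finset κ)}
    (hD : D ∈ nullSet (toDataset Mobs)) : (matricesOf Mobs D).Nonempty := by
  obtain ⟨M, hM, h⟩ := exists_matrix hD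
  exact ⟨M, mem_matricesOf.2 ⟨hM, h⟩⟩

theorem uniformDrawOr_matricesOf {Mobs : Matrix ρ κ Bool} {D : Multiset (Finset κ)}
    (hD : D ∈ nullSet (toDataset Mobs)) :
    uniformDrawOr (matricesOf Mobs D) Mobs PMF.pure =
      PMF.uniformOfFinset (matricesOf Mobs D) (matricesOf_nonempty hD) := by
  rw [uniformDrawOr_of_nonempty (matricesOf_nonempty hD), PMF.bind_pure]

variable {Mobs : Matrix ρ κ Bool} {P : PMF (Multiset (Finset κ))}
  (hP : ∀ D, D ∉ nullSet (toDataset Mobs) → P D = 0)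

include hP

theorem matrixLaw_apply_of_notMem {M : Matrix ρ κ Bool} (hM : M ∉ matrices Mobs) :
    matrixLaw Mobs P M = 0 := by
  rw [matrixLaw, PMF.bind_apply, ENNReal.tsum_eq_zero]
  intro D
  by_cases hD : D ∈ nullSet (toDataset Mobs)
  · rw [uniformDrawOr_matricesOf hD, PMF.uniformOfFinset_apply_of_notMem, mul_zero]
    exact fun h => hM (mem_matricesOf.1 h).1
  · rw [hP D hD, zero_mul]

/-- The fibre over a dataset of the null set has `copies` elements, so the two-stage draw has
density `target P`. That the target has total mass one needs no separate summation. -/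
theorem matrixLaw_apply {M : Matrix ρ κ Bool} (hM : M ∈ matrices Mobs) :
    matrixLaw Mobs P M = target P M := by
  have hD := toDataset_mem_nullSet hM
  rw [matrixLaw, PMF.bind_apply, tsum_eq_single (toDataset M)]
  · rw [uniformDrawOr_matricesOf hD, PMF.uniformOfFinset_apply_of_mem _ (mem_matricesOf.2 ⟨hM, rfl⟩),
      card_matricesOf hD, target, div_eq_mul_inv]
  · intro D hne
    by_cases hD : D ∈ nullSet (toDataset Mobs)
    · rw [uniformDrawOr_matricesOf hD, PMF.uniformOfFinset_apply_of_notMem, mul_zero]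
      exact fun h => hne (mem_matricesOf.1 h).2.symm
    · rw [hP D hD, zero_mul]

theorem map_matrixLaw : (matrixLaw Mobs P).map toDataset = P := by
  rw [matrixLaw, PMF.map_bind]
  conv_rhs => rw [← PMF.bind_pure P]
  refine bind_congr_of_ne_zero fun D hPD => ?_
  have hD : D ∈ nullSet (toDataset Mobs) := by
    by_contra h
    exact hPD (hP D h)
  rw [uniformDrawOr_matricesOf hD, PMF.map, bind_congr_of_ne_zero (g := fun _ => PMF.pure D),
    PMF.bind_const]
  intro M hM
  rw [← PMF.mem_support_iff, PMF.mem_support_uniformOfFinset_iff, mem_matricesOf] at hM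
  rw [Function.comp_apply, hM.2]

omit hP [DecidableEq ρ] [Fintype ρ] [Fintype κ] in
theorem copies_ne_zero (D : Multiset (Finset κ)) : (copies D : ℝ≥0∞) ≠ 0 := by
  exact_mod_cast (copies_pos D).ne'

omit hP [DecidableEq ρ] in
theorem target_ne_top (P : PMF (Multiset (Finset κ))) (M : Matrix ρ κ Bool) :
    target P M ≠ ⊤ :=
  ENNReal.div_ne_top (P.apply_ne_top _) (copies_ne_zero _)

omit hP in
theorem mem_of_aliceStep_ne_zero {M M' : Matrix ρ κ Bool} (hM : M ∈ matrices Mobs)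
    (h : aliceStep P M M' ≠ 0) : M' ∈ matrices Mobs := by
  by_cases hne : M' = M
  · rwa [hne]
  rw [aliceStep, mhStep_apply_of_ne hne] at h
  exact mem_matrices_of_isRSO hM (isRSO_of_proposal_ne_zero (left_ne_zero_of_mul h) hne)

/-- `target P` may be positive outside the state space, at row permutations that disturb the order
of the row sums. `matrixLaw` vanishes there, and the chain never crosses the boundary from inside.
-/
theorem matrixLaw_balance (M M' : Matrix ρ κ Bool) :
    matrixLaw Mobs P M * aliceStep P M M' = matrixLaw Mobs P M' * aliceStep P M' M := by
  by_cases hM : M ∈ matrices Mobs <;> by_cases hM' : M' ∈ matrices Mobs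
  · rw [matrixLaw_apply hP hM, matrixLaw_apply hP hM']
    exact mhStep_balance (target_ne_top P) _ _
  · rw [matrixLaw_apply_of_notMem hP hM', zero_mul, mul_eq_zero]
    exact Or.inr (not_not.1 fun h => hM' (mem_of_aliceStep_ne_zero hM h))
  · rw [matrixLaw_apply_of_notMem hP hM, zero_mul, eq_comm, mul_eq_zero]
    exact Or.inr (not_not.1 fun h => hM (mem_of_aliceStep_ne_zero hM' h))
  · rw [matrixLaw_apply_of_notMem hP hM, matrixLaw_apply_of_notMem hP hM', zero_mul, zero_mul]

theorem matrixLaw_bind_aliceStep :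
    (matrixLaw Mobs P).bind (aliceStep P) = matrixLaw Mobs P := by
  ext M
  rw [PMF.bind_apply]
  simp only [matrixLaw_balance hP _ M]
  rw [ENNReal.tsum_mul_left, PMF.tsum_coe, mul_one]

theorem matrixLaw_bind_chain (s : ℕ) :
    (matrixLaw Mobs P).bind (fun M => chain (aliceStep P) M s) = matrixLaw Mobs P := by
  induction s with
  | zero => exact PMF.bind_pure _
  | succ s ih =>
    simp only [chain]
    rw [← PMF.bind_bind, ih, matrixLaw_bind_aliceStep hP]

theorem matrixLaw_bind_aliceOutput (s : ℕ) : (matrixLaw Mobs P).bind (aliceOutput P s) = P := by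
  have : (matrixLaw Mobs P).bind (aliceOutput P s) =
      ((matrixLaw Mobs P).bind fun M => chain (aliceStep P) M s).map toDataset :=
    (PMF.map_bind _ _ _).symm
  rw [this, matrixLaw_bind_chain hP, map_matrixLaw hP]

omit hP in
-- `chain` appends steps at the end; splitting off the first step makes output probabilities
-- iterates of `markovOp`.
theorem chain_succ {S : Type*} (K : S → PMF S) (v : S) (s : ℕ) :
    chain K v (s + 1) = (K v).bind fun u => chain K u s := by
  induction s with
  | zero => simp only [chain, PMF.pure_bind, PMF.bind_pure]
  | succ s ih => rw [chain, ih, PMF.bind_bind]; rfl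

omit hP in
theorem aliceOutput_succ (P : PMF (Multiset (Finset κ))) (s : ℕ) (M : Matrix ρ κ Bool) :
    aliceOutput P (s + 1) M = (aliceStep P M).bind (aliceOutput P s) := by
  rw [aliceOutput, chain_succ, PMF.map_bind]
  rfl

omit hP [DecidableEq ρ] [Fintype ρ] [Fintype κ] [DecidableEq κ] in
theorem toReal_bind_apply {S β : Type*} [Fintype S] (p : PMF S) (f : S → PMF β) (b : β) :
    (p.bind f b).toReal = ∑ a, (p a).toReal * (f a b).toReal := by
  rw [PMF.bind_apply, tsum_fintype,
    ENNReal.toReal_sum fun a _ => ENNReal.mul_ne_top (p.apply_ne_top a) ((f a).apply_ne_top b)]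
  simp only [ENNReal.toReal_mul]

omit hP [DecidableEq ρ] [Fintype ρ] [Fintype κ] [DecidableEq κ] in
theorem sum_toReal {S : Type*} [Fintype S] (p : PMF S) : ∑ a, (p a).toReal = 1 := by
  rw [← ENNReal.toReal_sum fun a _ => p.apply_ne_top a, ← tsum_fintype (L := .unconditional S),
    PMF.tsum_coe, ENNReal.toReal_one]

theorem isReversible : IsReversible (fun M => (matrixLaw Mobs P M).toReal)
    (fun M M' => (aliceStep P M M').toReal) where
  nonneg _ := ENNReal.toReal_nonneg
  sum_eq_one := sum_toReal _
  kernel_nonneg _ _ := ENNReal.toReal_nonneg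
  kernel_sum _ := sum_toReal _
  balance M M' := by
    rw [← ENNReal.toReal_mul, ← ENNReal.toReal_mul, matrixLaw_balance hP]

omit hP [DecidableEq ρ] [Fintype ρ] [Fintype κ] [DecidableEq κ] in
theorem toReal_apply_pos_iff {S : Type*} (p : PMF S) (a : S) : 0 < (p a).toReal ↔ p a ≠ 0 := by
  rw [ENNReal.toReal_pos_iff, pos_iff_ne_zero, lt_top_iff_ne_top]
  exact and_iff_left (p.apply_ne_top a)

/-! ### Irreducibility and uniqueness when `P` charges the whole null set. -/

variable (hpos : ∀ D ∈ nullSet (toDataset Mobs), P D ≠ 0)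

omit hP

include hpos

omit [DecidableEq ρ] in
theorem target_ne_zero {M : Matrix ρ κ Bool} (hM : M ∈ matrices Mobs) : target P M ≠ 0 :=
  ENNReal.div_ne_zero.2 ⟨hpos _ (toDataset_mem_nullSet hM), ENNReal.natCast_ne_top _⟩

theorem aliceStep_ne_zero {M M' : Matrix ρ κ Bool} (hM : M ∈ matrices Mobs)
    (h : proposal M M' ≠ 0) : aliceStep P M M' ≠ 0 := by
  have hM' : M' ∈ matrices Mobs := by
    by_cases hne : M' = M
    · rwa [hne]
    · exact mem_matrices_of_isRSO hM (isRSO_of_proposal_ne_zero h hne)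
  refine mhStep_ne_zero h (mhAccept_ne_zero (target_ne_zero hpos hM') ?_ (target_ne_top P M))
  rwa [← proposal_apply_symm (fun a => by rw [hM.1, hM'.1]) fun c => by rw [hM.2.1, hM'.2.1]]

include hP

theorem matrixLaw_pos_iff {M : Matrix ρ κ Bool} :
    0 < (matrixLaw Mobs P M).toReal ↔ M ∈ matrices Mobs := by
  rw [toReal_apply_pos_iff]
  constructor
  · exact fun h => not_not.1 fun hM => h (matrixLaw_apply_of_notMem hP hM)
  · intro hM
    rw [matrixLaw_apply hP hM]
    exact target_ne_zero hpos hM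

theorem reflTransGen_aliceStep (M M' : Matrix ρ κ Bool) (hM : 0 < (matrixLaw Mobs P M).toReal)
    (hM' : 0 < (matrixLaw Mobs P M').toReal) :
    Relation.ReflTransGen (fun M M' => 0 < (aliceStep P M M').toReal) M M' := by
  rw [matrixLaw_pos_iff hP hpos] at hM hM'
  have h := reflTransGen_isRSO hM hM'
  suffices Relation.ReflTransGen (fun M M' => 0 < (aliceStep P M M').toReal) M M' ∧
    M' ∈ matrices Mobs from this.1
  clear hM'
  induction h with
  | refl => exact ⟨.refl, hM⟩
  | tail _ hs ih =>
    exact ⟨ih.1.tail ((toReal_apply_pos_iff _ _).2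
      (aliceStep_ne_zero hpos ih.2 (proposal_ne_zero_of_isRSO hs))), mem_matrices_of_isRSO ih.2 hs⟩

theorem eq_matrixLaw_of_stationary {ϖ : PMF (Matrix ρ κ Bool)}
    (h0 : ∀ M, M ∉ matrices Mobs → ϖ M = 0) (hst : ϖ.bind (aliceStep P) = ϖ) :
    ϖ = matrixLaw Mobs P := by
  have key := (isReversible hP).eq_of_stationary (reflTransGen_aliceStep hP hpos)
    (μ := fun M => (ϖ M).toReal) (fun M hM => by
      rw [h0 M fun h => ((matrixLaw_pos_iff hP hpos).2 h).ne' hM, ENNReal.toReal_zero])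
    (sum_toReal ϖ) (fun M => by rw [← toReal_bind_apply, hst])
  ext M
  exact (ENNReal.toReal_eq_toReal_iff' (ϖ.apply_ne_top M) (PMF.apply_ne_top _ M)).1
    (congrFun key M)

omit hP hpos

/-! ### The exchange of two rows -/

/-- The exchange of the rows `a` and `b`. -/
def rowExchange (a b : ρ) : Equiv.Perm (Matrix ρ κ Bool) :=
  Function.Involutive.toPerm (fun M => M.submatrix (Equiv.swap a b) id) fun M => by
    ext i j
    simp

omit [Fintype ρ] [Fintype κ] [DecidableEq κ] in
theorem rowExchange_apply (a b : ρ) (M : Matrix ρ κ Bool) :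
    rowExchange a b M = M.submatrix (Equiv.swap a b) id := rfl

omit [DecidableEq κ] in
theorem toDataset_rowExchange (a b : ρ) (M : Matrix ρ κ Bool) :
    toDataset (rowExchange a b M) = toDataset M :=
  toDataset_submatrix M _

theorem rowExchange_mem {a b : ρ} (hab : rowSum Mobs a = rowSum Mobs b) {M : Matrix ρ κ Bool}
    (hM : M ∈ matrices Mobs) : rowExchange a b M ∈ matrices Mobs := by
  refine mem_matrices_of_nullSet (by rw [toDataset_rowExchange]; exact toDataset_mem_nullSet hM)
    fun x => ?_
  rw [rowExchange_apply, rowSum_submatrix, hM.1, Equiv.swap_apply_def]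
  split_ifs with h1 h2
  · rw [h1, hab]
  · rw [h2, hab]
  · rfl

theorem rowExchange_mem_iff {a b : ρ} (hab : rowSum Mobs a = rowSum Mobs b)
    {M : Matrix ρ κ Bool} : rowExchange a b M ∈ matrices Mobs ↔ M ∈ matrices Mobs := by
  refine ⟨fun h => ?_, rowExchange_mem hab⟩
  have := rowExchange_mem hab h
  rwa [show rowExchange a b (rowExchange a b M) = M from
    (rowExchange a b).left_inv M] at this

/-- A function that changes its sign along each proposed move vanishes at matrices that lie on a
triangle of swaps. -/
theorem eq_zero_of_triangle {h : Matrix ρ κ Bool → ℝ}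
    (hh : ∀ M ∈ matrices Mobs, ∀ M', proposal M M' ≠ 0 → h M' = -h M) {M : Matrix ρ κ Bool}
    (hM : M ∈ matrices Mobs) {a b : ρ} (hab : rowSum Mobs a = rowSum Mobs b) {c d x : κ}
    (h1 : M a c = true) (h2 : M a x = true) (h3 : M a d = false) (h4 : M b c = false)
    (h5 : M b x = false) (h6 : M b d = true) (hcx : c ≠ x) : h M = 0 := by
  have hne : a ≠ b := by rintro rfl; simp_all
  have hcd : c ≠ d := by rintro rfl; simp_all
  have hxd : x ≠ d := by rintro rfl; simp_all
  have step : ∀ M ∈ matrices Mobs, ∀ c d, M a c = true → M b d = true → M a d = false →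
      M b c = false → h (swapEntries M a b c d) = -h M ∧ swapEntries M a b c d ∈ matrices Mobs := by
    intro M hM c d g1 g2 g3 g4
    have hR : IsRSO M (swapEntries M a b c d) :=
      isRSO_iff.2 ⟨a, b, c, d, Or.inl (by rw [hM.1, hM.1, hab]), g1, g2, g3, g4, rfl⟩
    exact ⟨hh M hM _ (proposal_ne_zero_of_isRSO hR), mem_matrices_of_isRSO hM hR⟩
  -- On columns `c`, `x`, `d` row `a` reads 110 and row `b` reads 001. The one of row `b` travels
  -- from `d` to `c` to `x` and back to `d`: three sign changes on a closed walk.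
  obtain ⟨e1, m1⟩ := step M hM c d h1 h6 h3 h4
  obtain ⟨e2, m2⟩ := step _ m1 x c
    (by simp [swapEntries, Equiv.swap_apply_of_ne_of_ne, hcx.symm, hxd, h2])
    (by simp [swapEntries, h6]) (by simp [swapEntries, h3])
    (by simp [swapEntries, Equiv.swap_apply_of_ne_of_ne, hcx.symm, hxd, h5])
  obtain ⟨e3, -⟩ := step _ m2 d x
    (by simp [swapEntries, Equiv.swap_apply_of_ne_of_ne, hcd.symm, hxd.symm, h1])
    (by simp [swapEntries, h6])
    (by simp [swapEntries, h3])
    (by simp [swapEntries, Equiv.swap_apply_of_ne_of_ne, hcd.symm, hxd.symm, h4])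
  have hcycle : swapEntries (swapEntries (swapEntries M a b c d) a b x c) a b d x = M := by
    ext i j
    by_cases hi : i = a ∨ i = b
    · have hcx' : M i c = M i x := by
        rcases hi with rfl | rfl
        · rw [h1, h2]
        · rw [h4, h5]
      simp only [swapEntries, hi, if_true]
      by_cases j1 : j = d
      · simp [j1]
      by_cases j2 : j = x
      · simp [j2, Equiv.swap_apply_of_ne_of_ne, hcd.symm, hxd.symm, hcx']
      by_cases j3 : j = c
      · simp [j3, Equiv.swap_apply_of_ne_of_ne, hcd, hcx, hcx.symm, hxd, hcx']
      · simp [j1, j2, j3, Equiv.swap_apply_of_ne_of_ne]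
    · simp [swapEntries, hi]
  rw [hcycle, e2, e1] at e3
  linarith

/-- Equal rows: the exchange is a void move that is proposed. Rows that differ in exactly two
columns: it is a single swap. Otherwise a third differing column puts both `M` and its exchange on
triangles, and `h` vanishes at both. -/
theorem rowExchange_sign {h : Matrix ρ κ Bool → ℝ}
    (hh : ∀ M ∈ matrices Mobs, ∀ M', proposal M M' ≠ 0 → h M' = -h M) {a b : ρ} (hne : a ≠ b)
    (hab : rowSum Mobs a = rowSum Mobs b) (hpos : 0 < rowSum Mobs a) {M : Matrix ρ κ Bool}
    (hM : M ∈ matrices Mobs) : h (rowExchange a b M) = -h M := by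
  have hsum : rowSum M a = rowSum M b := by rw [hM.1, hM.1, hab]
  by_cases heq : M a = M b
  · have h1 : rowExchange a b M = M := by
      ext i j
      rw [rowExchange_apply, Matrix.submatrix_apply, Equiv.swap_apply_def, id]
      split_ifs with g1 g2
      · rw [g1, heq]
      · rw [g2, heq]
      · rfl
    rw [h1]
    refine hh M hM M ((proposal_ne_zero_iff _ _).2 (Or.inl ?_))
    refine rowProposal_ne_zero hne hsum (by rwa [hM.1]) ?_
    rw [rowMove, if_pos heq]
    simp
  have hpair : ∃ c d, M a c = true ∧ M b c = false ∧ M a d = false ∧ M b d = true := by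
    rw [rowSum_eq_rowSpec, rowSum_eq_rowSpec, rowSpec, rowSpec] at hsum
    obtain ⟨c, hc⟩ := Function.ne_iff.1 heq
    cases hca : M a c <;> cases hcb : M b c
    · simp_all
    · obtain ⟨d, -, hd, hd'⟩ := exists_of_card_le (p := fun _ => () = ()) (u := M b) (v := M a)
        hsum.ge rfl hcb hca
      exact ⟨d, c, hd, hd', hca, hcb⟩
    · obtain ⟨d, -, hd, hd'⟩ := exists_of_card_le (p := fun _ => () = ()) (u := M a) (v := M b)
        hsum.le rfl hca hcb
      exact ⟨c, d, hca, hcb, hd', hd⟩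
    · simp_all
  obtain ⟨c, d, h1, h2, h3, h4⟩ := hpair
  have hEa : ∀ j, rowExchange a b M a j = M b j := fun j => by simp [rowExchange_apply]
  have hEb : ∀ j, rowExchange a b M b j = M a j := fun j => by simp [rowExchange_apply]
  have hEM := rowExchange_mem hab hM
  by_cases hx : ∃ x, x ≠ c ∧ x ≠ d ∧ M a x ≠ M b x
  · obtain ⟨x, hxc, hxd, hx⟩ := hx
    cases hxa : M a x
    · have hxb : M b x = true := by simpa [hxa] using hx
      rw [eq_zero_of_triangle hh hM hab.symm h4 hxb h2 h3 hxa h1 hxd.symm,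
        eq_zero_of_triangle hh hEM hab ((hEa d).trans h4) ((hEa x).trans hxb) ((hEa c).trans h2)
          ((hEb d).trans h3) ((hEb x).trans hxa) ((hEb c).trans h1) hxd.symm, neg_zero]
    · have hxb : M b x = false := by simpa [hxa] using hx
      rw [eq_zero_of_triangle hh hM hab h1 hxa h3 h2 hxb h4 hxc.symm,
        eq_zero_of_triangle hh hEM hab.symm ((hEb c).trans h1) ((hEb x).trans hxa)
          ((hEb d).trans h3) ((hEa c).trans h2) ((hEa x).trans hxb) ((hEa d).trans h4) hxc.symm,
        neg_zero]
  · push Not at hx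
    have hcd : c ≠ d := by rintro rfl; simp_all
    have hE : rowExchange a b M = swapEntries M a b c d := by
      ext i j
      by_cases hi : i = a
      · subst hi
        rw [hEa]
        by_cases j1 : j = c
        · simp [swapEntries, j1, h2, h3]
        by_cases j2 : j = d
        · simp [swapEntries, j2, h1, h4]
        simp [swapEntries, Equiv.swap_apply_of_ne_of_ne, j1, j2, hx j j1 j2]
      by_cases hi' : i = b
      · subst hi'
        rw [hEb]
        by_cases j1 : j = c
        · simp [swapEntries, j1, h1, h4]
        by_cases j2 : j = d
        · simp [swapEntries, j2, h2, h3]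
        simp [swapEntries, Equiv.swap_apply_of_ne_of_ne, j1, j2, hx j j1 j2]
      simp [swapEntries, rowExchange_apply, hi, hi', Equiv.swap_apply_of_ne_of_ne]
    rw [hE]
    exact hh M hM _ (proposal_ne_zero_of_isRSO
      (isRSO_iff.2 ⟨a, b, c, d, Or.inl hsum, h1, h4, h3, h2, rfl⟩))

include hP hpos

theorem exists_symmetry : ∃ τ : Equiv.Perm (Matrix ρ κ Bool),
    (∀ M, (matrixLaw Mobs P (τ M)).toReal = (matrixLaw Mobs P M).toReal) ∧
    (∀ M, toDataset (τ M) = toDataset M) ∧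
    ∀ h : Matrix ρ κ Bool → ℝ, (∀ M M', 0 < (matrixLaw Mobs P M).toReal →
      0 < (aliceStep P M M').toReal → h M' = -h M) →
      ∀ M, 0 < (matrixLaw Mobs P M).toReal → h (τ M) = -h M := by
  have hstep : ∀ h : Matrix ρ κ Bool → ℝ, (∀ M M', 0 < (matrixLaw Mobs P M).toReal →
      0 < (aliceStep P M M').toReal → h M' = -h M) →
      ∀ M ∈ matrices Mobs, ∀ M', proposal M M' ≠ 0 → h M' = -h M :=
    fun h hh M hM M' hp => hh M M' ((matrixLaw_pos_iff hP hpos).2 hM)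
      ((toReal_apply_pos_iff _ _).2 (aliceStep_ne_zero hpos hM hp))
  by_cases hdist : ∀ a b, rowSum Mobs a = rowSum Mobs b → 0 < rowSum Mobs a → a = b
  -- The self-loop at every state forces `h M = -h M`, so the identity serves as symmetry.
  · refine ⟨Equiv.refl _, fun _ => rfl, fun _ => rfl, fun h hh M hM => ?_⟩
    have hM' := (matrixLaw_pos_iff hP hpos).1 hM
    refine hstep h hh M hM' M ((proposal_ne_zero_iff _ _).2 (Or.inl ?_))
    exact rowProposal_self_ne_zero fun a b => by simpa only [hM'.1] using hdist a b
  · push Not at hdist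
    obtain ⟨a, b, hab, hsum, hne⟩ := hdist
    refine ⟨rowExchange a b, fun M => ?_, toDataset_rowExchange a b, fun h hh M hM => ?_⟩
    · by_cases hM : M ∈ matrices Mobs
      · rw [matrixLaw_apply hP hM, matrixLaw_apply hP (rowExchange_mem hab hM), target, target,
          toDataset_rowExchange]
      · rw [matrixLaw_apply_of_notMem hP hM,
          matrixLaw_apply_of_notMem hP (mt (rowExchange_mem_iff hab).1 hM)]
    · exact rowExchange_sign (hstep h hh) hne hab hsum ((matrixLaw_pos_iff hP hpos).1 hM)

/-- From every starting matrix the law of the output converges to `P`. -/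
theorem tendsto_aliceOutput {M : Matrix ρ κ Bool} (hM : M ∈ matrices Mobs)
    (D : Multiset (Finset κ)) :
    Filter.Tendsto (fun s : ℕ => aliceOutput P s M D) Filter.atTop (𝓝 (P D)) := by
  obtain ⟨τ, hτπ, hτD, hτ⟩ := exists_symmetry hP hpos
  have key := (isReversible hP).tendsto_iterate (reflTransGen_aliceStep hP hpos)
    (f := fun s M => (aliceOutput P s M D).toReal) (fun s => by
      ext M
      rw [aliceOutput_succ, toReal_bind_apply]
      rfl)
    τ hτπ (fun M => by simp only [aliceOutput, chain, PMF.pure_map, hτD]) hτ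
    ((matrixLaw_pos_iff hP hpos).2 hM)
  -- The limiting average is the output law at time zero of the chain started from `matrixLaw`,
  -- which is `P`.
  rw [← toReal_bind_apply, matrixLaw_bind_aliceOutput hP] at key
  exact (ENNReal.tendsto_toReal_iff (fun s => PMF.apply_ne_top _ D) (P.apply_ne_top D)).1 key

end Chain

end Alice

theorem mainTheorem1 {ρ κ : Type*} [Fintype ρ] [Fintype κ] [DecidableEq ρ] [DecidableEq κ]
    (Dobs : Multiset (Finset κ)) (Mobs : Matrix ρ κ Bool) (hobs : Alice.toDataset Mobs = Dobs)
    (P : PMF (Multiset (Finset κ))) (hP : ∀ D, D ∉ Alice.nullSet Dobs → P D = 0) :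
    -- the proposals are restricted swap operations within the state space, or void moves
    (∀ M ∈ Alice.matrices Mobs, ∀ M',
      (Alice.IsRSO M M' → M' ∈ Alice.matrices Mobs ∧ Alice.proposal M M' ≠ 0) ∧
      (Alice.proposal M M' ≠ 0 → M' = M ∨ Alice.IsRSO M M')) ∧
    -- the proposal is symmetric
    (∀ M ∈ Alice.matrices Mobs, ∀ M' ∈ Alice.matrices Mobs,
      Alice.proposal M M' = Alice.proposal M' M) ∧
    -- `C(D)` is the number of matrices in the state space with dataset `D`
    (∀ D ∈ Alice.nullSet Dobs,
      {M | M ∈ Alice.matrices Mobs ∧ Alice.toDataset M = D}.ncard = Alice.copies D) ∧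
    ∃ ϖ : PMF (Matrix ρ κ Bool),
      -- the target is a probability distribution on the state space
      (∀ M ∈ Alice.matrices Mobs, ϖ M = Alice.target P M) ∧
      (∀ M, M ∉ Alice.matrices Mobs → ϖ M = 0) ∧
      -- it is stationary, and the output of the stationary chain has law `P`
      ϖ.bind (Alice.aliceStep P) = ϖ ∧
      (∀ s : ℕ, ϖ.bind (Alice.aliceOutput P s) = P) ∧
      ((∀ D ∈ Alice.nullSet Dobs, P D ≠ 0) →
        -- it is the only stationary distribution on the state space
        (∀ ϖ' : PMF (Matrix ρ κ Bool), (∀ M, M ∉ Alice.matrices Mobs → ϖ' M = 0) →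
          ϖ'.bind (Alice.aliceStep P) = ϖ' → ϖ' = ϖ) ∧
        -- from every starting matrix the law of the output converges to `P`
        (∀ M ∈ Alice.matrices Mobs, ∀ D ∈ Alice.nullSet Dobs,
          Filter.Tendsto (fun s : ℕ => Alice.aliceOutput P s M D) Filter.atTop (𝓝 (P D)))) := by
  subst hobs
  refine ⟨fun M hM M' => ⟨fun h => ⟨Alice.mem_matrices_of_isRSO hM h,
    Alice.proposal_ne_zero_of_isRSO h⟩, fun h => ?_⟩, fun M hM M' hM' => ?_,
    fun D hD => Alice.ncard_toDataset_eq hD, Alice.matrixLaw Mobs P,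
    fun M hM => Alice.matrixLaw_apply hP hM, fun M hM => Alice.matrixLaw_apply_of_notMem hP hM,
    Alice.matrixLaw_bind_aliceStep hP, Alice.matrixLaw_bind_aliceOutput hP,
    fun hpos => ⟨fun ϖ' h0 hst => Alice.eq_matrixLaw_of_stationary hP hpos h0 hst,
      fun M hM D _ => Alice.tendsto_aliceOutput hP hpos hM D⟩⟩
  · by_cases hne : M' = M
    · exact Or.inl hne
    · exact Or.inr (Alice.isRSO_of_proposal_ne_zero h hne)
  · exact Alice.proposal_apply_symm (fun a => by rw [hM.1, hM'.1])
      fun c => by rw [hM.2.1, hM'.2.1]
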